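/- Fix a field $K$ and an integer $d\ge 1$. A $d$-uniform clutter $C$ consists of a finite vertex set $V(C)$ and a set of $d$-element subsets of $V(C)$, called circuits. Its circuit ideal is the ideal $I(\bar C)$ of the polynomial ring $K[x_v : v\in V(C)]$ generated by the monomials $\prod_{v\in T}x_v$, where $T$ runs over the $d$-element subsets of $V(C)$ that are not circuits of $C$. A subset $W\subseteq V(C)$ is a clique of $C$ if every $d$-element subset of $W$ is a circuit of $C$ (so a set with fewer than $d$ elements is a clique), and $\mathrm{SC}(C)$ denotes the set of $(d-1)$-element subsets of $V(C)$ that are contained in a circuit of $C$. For a homogeneous ideal $J$ of a polynomial ring $S$ over $K$ in finitely many variables, let $\beta_{i,j}(J)=\dim_K \mathrm{Tor}^S_i(K,J)_j$ be its graded Betti numbers and $\mathrm{reg}(J)=\sup\{j-i : \beta_{i,j}(J)\neq 0\}$ its Castelnuovo–Mumford regularity. Let $C$, $C_1$, $C_2$ be $d$-uniform clutters such that $V(C_1),V(C_2)\subseteq V(C)$, the set of circuits of $C$ is the union of the sets of circuits of $C_1$ and of $C_2$, and at least one of the following holds: (a) $V(C_1)\cap V(C_2)$ is a clique of both $C_1$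 and $C_2$; (b) $\mathrm{SC}(C_1)\cap \mathrm{SC}(C_2)=\varnothing$. Let $I$, $I_1$, $I_2$ be the circuit ideals of $C$, $C_1$, $C_2$. Then: (i) $\beta_{i,j}(I)\ge \beta_{i,j}(I_1)+\beta_{i,j}(I_2)$ for all integers $i,j\ge 0$ with $j-i>d$. (ii) If $I_1\neq 0$ and $I_2\neq 0$, then $\mathrm{reg}(I)=\max\{\mathrm{reg}(I_1),\mathrm{reg}(I_2)\}$. -/

import Mathlib

/-! ### Graded Betti numbers and regularity of an ideal of a polynomial ring -/

noncomputable section Koszul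

set_option linter.unusedSectionVars false

open MvPolynomial

variable (K : Type*) [Field K] {σ : Type*} [Fintype σ] [LinearOrder σ]

/-- The sign `(-1) ^ #{u ∈ B | u < v}` of moving `e_v` to its place in `e_B`. -/
def koszulSign (v : σ) (B : Finset σ) : MvPolynomial σ K :=
  (-1) ^ (B.filter (fun u => u < v)).card

/-- The differential of the Koszul complex of the variables of `S = K[x_v : v ∈ σ]`.
The free module `⨁_A S e_A`, with `A` running over the subsets of `σ`, is written as
`Finset σ → S`; the basis vector `e_A` sits in homological degree `|A|`. The differential is
`∂ e_A = ∑_{v ∈ A} (-1) ^ #{u ∈ A | u < v} x_v e_{A \ v}`. -/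
def koszulD : (Finset σ → MvPolynomial σ K) →ₗ[MvPolynomial σ K]
    (Finset σ → MvPolynomial σ K) :=
  LinearMap.pi fun B =>
    ∑ v ∈ Bᶜ, (koszulSign K v B * X v) • LinearMap.proj (insert v B)

theorem koszulD_apply (c : Finset σ → MvPolynomial σ K) (B : Finset σ) :
    koszulD K c B = ∑ v ∈ Bᶜ, koszulSign K v B * X v * c (insert v B) := by
  simp [koszulD]

theorem koszulSign_mul_self (v : σ) (B : Finset σ) :
    koszulSign K v B * koszulSign K v B = 1 := by
  rw [koszulSign, ← pow_add, Even.neg_one_pow ⟨_, rfl⟩]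

theorem koszulSign_insert (v w : σ) (B : Finset σ) (hv : v ∉ B) :
    koszulSign K w (insert v B) = if v < w then -koszulSign K w B else koszulSign K w B := by
  unfold koszulSign
  rw [Finset.filter_insert]
  split_ifs with h
  · rw [Finset.card_insert_of_notMem (by simp [hv]), pow_succ]; ring
  · rfl

theorem koszulSign_swap (v w : σ) (B : Finset σ) (hvw : v ≠ w) (hv : v ∉ B) (hw : w ∉ B) :
    koszulSign K v B * koszulSign K w (insert v B) =
      -(koszulSign K w B * koszulSign K v (insert w B)) := by
  rw [koszulSign_insert K v w B hv, koszulSign_insert K w v B hw]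
  rcases lt_or_gt_of_ne hvw with h | h
  · rw [if_pos h, if_neg h.not_gt]; ring
  · rw [if_neg h.not_gt, if_pos h]; ring

theorem koszulD_koszulD (c : Finset σ → MvPolynomial σ K) : koszulD K (koszulD K c) = 0 := by
  funext B
  simp only [koszulD_apply, Finset.mul_sum, Pi.zero_apply]
  rw [Finset.sum_sigma']
  refine Finset.sum_involution (fun p _ => ⟨p.2, p.1⟩) ?_ ?_ ?_ ?_
  · rintro ⟨v, w⟩ h
    simp only [Finset.mem_sigma, Finset.mem_compl, Finset.mem_insert, not_or] at h
    obtain ⟨hv, hne, hw⟩ := h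
    have hs := koszulSign_swap K v w B (Ne.symm hne) hv hw
    dsimp only
    rw [Finset.insert_comm w v B]
    linear_combination X v * X w * c (insert v (insert w B)) * hs
  · rintro ⟨v, w⟩ h _ heq
    simp only [Finset.mem_sigma, Finset.mem_compl, Finset.mem_insert, not_or] at h
    simp only [Sigma.mk.injEq] at heq
    exact h.2.1 heq.1
  · rintro ⟨v, w⟩ h
    simp only [Finset.mem_sigma, Finset.mem_compl, Finset.mem_insert, not_or] at h ⊢
    exact ⟨h.2.2, Ne.symm h.2.1, h.1⟩
  · rintro ⟨v, w⟩ _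
    rfl

/-- Contraction of the Koszul complex in the direction of the variable `x_v`. -/
def koszulH (v : σ) (c : Finset σ → MvPolynomial σ K) : Finset σ → MvPolynomial σ K := fun B =>
  if v ∈ B then
    koszulSign K v (B.erase v) * (c (B.erase v)).divMonomial (Finsupp.single v 1)
  else 0

theorem koszul_divMonomial_comm (v w : σ) (hvw : w ≠ v) (p : MvPolynomial σ K) :
    (X w * p).divMonomial (Finsupp.single v 1) = X w * p.divMonomial (Finsupp.single v 1) := by
  ext m
  classical
  simp only [coeff_divMonomial, coeff_X_mul', Finsupp.mem_support_iff, Finsupp.add_apply,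
    Finsupp.single_apply, if_neg (Ne.symm hvw), zero_add]
  split_ifs with h
  · congr 1
    ext u
    simp only [Finsupp.tsub_apply, Finsupp.add_apply, Finsupp.single_apply]
    by_cases h1 : w = u
    · subst h1; simp [Ne.symm hvw]
    · simp [h1]
  · rfl

theorem koszul_divMonomial_sign (v w : σ) (B : Finset σ) (p : MvPolynomial σ K) :
    (koszulSign K w B * p).divMonomial (Finsupp.single v 1) =
      koszulSign K w B * p.divMonomial (Finsupp.single v 1) := by
  have h1 : ∀ q : MvPolynomial σ K, (-q).divMonomial (Finsupp.single v 1) =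
      -q.divMonomial (Finsupp.single v 1) := by
    intro q; ext m; simp [coeff_divMonomial]
  unfold koszulSign
  rcases neg_one_pow_eq_or (MvPolynomial σ K) (B.filter (fun u => u < w)).card with h | h <;>
    simp [h, h1]

theorem koszul_divMonomial_sum (v : σ) {ι : Type*} (s : Finset ι)
    (f : ι → MvPolynomial σ K) :
    (∑ k ∈ s, f k).divMonomial (Finsupp.single v 1) =
      ∑ k ∈ s, (f k).divMonomial (Finsupp.single v 1) := by
  ext m; simp [coeff_divMonomial, coeff_sum]

/-- The contraction is a homotopy between the identity and the reduction modulo `x_v`. -/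
theorem koszul_homotopy (v : σ) (c : Finset σ → MvPolynomial σ K) (hc : koszulD K c = 0)
    (B : Finset σ) :
    c B - koszulD K (koszulH K v c) B =
      if v ∈ B then 0 else (c B).modMonomial (Finsupp.single v 1) := by
  rw [koszulD_apply]
  split_ifs with hv
  · have h0 := congrFun hc (B.erase v)
    rw [koszulD_apply, Pi.zero_apply] at h0
    have hcompl : (B.erase v)ᶜ = insert v Bᶜ := by
      ext u; by_cases h : u = v <;> simp [h]
    rw [hcompl, Finset.sum_insert (by simpa using hv), Finset.insert_erase hv] at h0
    have h1 := congrArg (fun p => koszulSign K v (B.erase v) *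
      p.divMonomial (Finsupp.single v 1)) h0
    simp only [add_divMonomial, koszul_divMonomial_sum, zero_divMonomial, mul_zero] at h1
    rw [mul_assoc, koszul_divMonomial_sign, X_mul_divMonomial, mul_add, ← mul_assoc,
      koszulSign_mul_self, one_mul, Finset.mul_sum] at h1
    rw [← h1, sub_eq_add_neg, ← Finset.sum_neg_distrib]
    congr 1
    refine Finset.sum_congr rfl fun i hi => ?_
    have hiB : i ∉ B := by simpa using hi
    have hiv : i ≠ v := fun h => hiB (h ▸ hv)
    have hiE : i ∉ B.erase v := fun h => hiB (Finset.mem_of_mem_erase h)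
    have hs := koszulSign_swap K i v (B.erase v) hiv hiE (Finset.notMem_erase v B)
    rw [Finset.insert_erase hv] at hs
    have e1 := koszulSign_mul_self K v (B.erase v)
    have e2 := koszulSign_mul_self K v (insert i (B.erase v))
    rw [koszulH, if_pos (Finset.mem_insert_of_mem hv), Finset.erase_insert_of_ne hiv, mul_assoc,
      mul_assoc, koszul_divMonomial_sign, koszul_divMonomial_comm K v i hiv]
    generalize (c (insert i (B.erase v))).divMonomial (Finsupp.single v 1) = q
    linear_combination (-(X i * q * koszulSign K v (B.erase v) *
      koszulSign K v (insert i (B.erase v)))) * hs +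
      (X i * q * koszulSign K i B * koszulSign K v (insert i (B.erase v))) * e1 +
      (X i * q * koszulSign K i (B.erase v) * koszulSign K v (B.erase v)) * e2
  · have hv' : v ∈ Bᶜ := by simpa using hv
    rw [Finset.sum_eq_single_of_mem v hv']
    · rw [koszulH, if_pos (Finset.mem_insert_self v B), Finset.erase_insert hv]
      have e1 := koszulSign_mul_self K v B
      have e2 := divMonomial_add_modMonomial_single (c B) v
      linear_combination (-(X v * (c B).divMonomial (Finsupp.single v 1))) * e1 - e2
    · intro w _ hwv
      have : v ∉ insert w B := by simp [hv, Ne.symm hwv]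
      rw [koszulH, if_neg this, mul_zero]

theorem koszulD_constantCoeff (b : Finset σ → MvPolynomial σ K) :
    constantCoeff (koszulD K b ∅) = 0 := by
  simp [koszulD_apply]

/-- The augmented Koszul complex `⋯ → ⨁_{|A| = 1} S e_A → S e_∅ → K → 0` is exact: together with
the freeness of its terms, the Koszul complex is a graded free resolution of `K`. -/
theorem koszul_resolution (c : Finset σ → MvPolynomial σ K) :
    (koszulD K c = 0 ∧ constantCoeff (c ∅) = 0) ↔ ∃ b, koszulD K b = c := by
  constructor
  · rintro ⟨hc, h0⟩
    have key : ∀ T : Finset σ, ∃ b, ∀ v ∈ T, ∀ B : Finset σ,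
        (v ∈ B → (c - koszulD K b : Finset σ → MvPolynomial σ K) B = 0) ∧
          ∀ m : σ →₀ ℕ, m v ≠ 0 → coeff m ((c - koszulD K b : Finset σ → MvPolynomial σ K) B) = 0 := by
      intro T
      induction T using Finset.induction_on with
      | empty => exact ⟨0, by simp⟩
      | insert w T _ ih =>
        obtain ⟨b, hb⟩ := ih
        refine ⟨b + koszulH K w (c - koszulD K b), fun v hv B => ?_⟩
        have hcyc : koszulD K (c - koszulD K b) = 0 := by
          rw [map_sub, hc, koszulD_koszulD, sub_zero]
        have hom := koszul_homotopy K w _ hcyc B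
        rw [map_add, ← sub_sub, Pi.sub_apply, hom]
        have hmod : ∀ m : σ →₀ ℕ, coeff m (((c - koszulD K b : Finset σ → MvPolynomial σ K) B).modMonomial
            (Finsupp.single w 1)) = 0 ∨ (m w = 0 ∧ coeff m (((c - koszulD K b : Finset σ → MvPolynomial σ K) B).modMonomial
            (Finsupp.single w 1)) = coeff m ((c - koszulD K b : Finset σ → MvPolynomial σ K) B)) := by
          intro m
          by_cases hm : m w = 0
          · refine Or.inr ⟨hm, coeff_modMonomial_of_not_le _ fun hle => ?_⟩
            have := hle w
            simp [hm] at this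
          · refine Or.inl (coeff_modMonomial_of_le _ ?_)
            rw [Finsupp.single_le_iff]
            omega
        split_ifs with hwB
        · simp
        · rcases Finset.mem_insert.mp hv with rfl | hvT
          · refine ⟨fun h => absurd h hwB, fun m hm => ?_⟩
            rcases hmod m with h | h
            · exact h
            · exact absurd h.1 hm
          · refine ⟨fun h => ?_, fun m hm => ?_⟩
            · ext m
              rcases hmod m with h' | h'
              · simpa using h'
              · rw [h'.2, (hb v hvT B).1 h]
            · rcases hmod m with h' | h'
              · exact h'
              · rw [h'.2, (hb v hvT B).2 m hm]
    obtain ⟨b, hb⟩ := key Finset.univ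
    refine ⟨b, (sub_eq_zero.mp ?_).symm⟩
    funext B
    rcases B.eq_empty_or_nonempty with rfl | ⟨v, hv⟩
    · ext m
      by_cases hm : m = 0
      · subst hm
        have : constantCoeff ((c - koszulD K b : Finset σ → MvPolynomial σ K) ∅) = 0 := by
          rw [Pi.sub_apply, map_sub, h0, koszulD_constantCoeff, sub_zero]
        simpa [constantCoeff_eq] using this
      · obtain ⟨v, hv⟩ := Finsupp.ne_iff.mp hm
        simpa using (hb v (Finset.mem_univ v) ∅).2 m hv
    · exact (hb v (Finset.mem_univ v) B).1 hv
  · rintro ⟨b, rfl⟩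
    exact ⟨koszulD_koszulD K b, koszulD_constantCoeff K b⟩

variable {K}

/-- The part of homological degree `i` and internal degree `j` of the complex
`(Koszul complex) ⊗ I = ⨁_A I e_A`, where `e_A` has internal degree `|A|`: families supported on
the `i`-subsets `A` whose coefficients are elements of `I` homogeneous of degree `j - i`. -/
def koszulStrand (I : Ideal (MvPolynomial σ K)) (i j : ℕ) :
    Submodule K (Finset σ → MvPolynomial σ K) :=
  Submodule.pi Set.univ fun A =>
    if A.card = i ∧ i ≤ j then
      I.restrictScalars K ⊓ homogeneousSubmodule σ K (j - i)
    else ⊥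

/-- The cycles of homological degree `i` and internal degree `j`. -/
def koszulCycles (I : Ideal (MvPolynomial σ K)) (i j : ℕ) :
    Submodule K (Finset σ → MvPolynomial σ K) :=
  koszulStrand I i j ⊓ LinearMap.ker ((koszulD (σ := σ) K).restrictScalars K)

/-- The boundaries of homological degree `i` and internal degree `j`. -/
def koszulBoundaries (I : Ideal (MvPolynomial σ K)) (i j : ℕ) :
    Submodule K (Finset σ → MvPolynomial σ K) :=
  (koszulStrand I (i + 1) j).map ((koszulD (σ := σ) K).restrictScalars K)

/-- The graded Betti number `β_{i,j}(I) = dim_K Tor_i^S(K, I)_j` of a homogeneous ideal `I` of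
`S = K[x_v : v ∈ σ]`. The graded `Tor` is computed from the Koszul complex, which is a graded free
resolution of the residue field `K` (see `koszul_resolution` above), tensored with `I`. -/
def gradedBetti (I : Ideal (MvPolynomial σ K)) (i j : ℕ) : ℕ :=
  Module.finrank K
    (koszulCycles I i j ⧸ (koszulBoundaries I i j).submoduleOf (koszulCycles I i j))

/-- The Castelnuovo-Mumford regularity `sup {j - i : β_{i,j}(I) ≠ 0}`; the supremum is taken in
the extended reals, so that no value is junk. -/
def regularity (I : Ideal (MvPolynomial σ K)) : EReal :=
  ⨆ (i : ℕ) (j : ℕ) (_ : gradedBetti I i j ≠ 0), (((j : ℝ) - (i : ℝ) : ℝ) : EReal)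

end Koszul

/-! ### Clutters -/

noncomputable section Clutters

/-- A clutter: a finite vertex set together with a set of subsets of it, the circuits, none of
which contains another. -/
structure Clutter (α : Type*) where
  verts : Finset α
  circuits : Finset (Finset α)
  subset_verts : ∀ F ∈ circuits, F ⊆ verts
  antichain : IsAntichain (· ⊆ ·) (circuits : Set (Finset α))

namespace Clutter

variable {α : Type*}

/-- Every circuit has exactly `d` vertices. -/
def IsUniform (C : Clutter α) (d : ℕ) : Prop :=
  ∀ F ∈ C.circuits, F.card = d

/-- `W` is a clique of the `d`-uniform clutter `C`: a set of vertices all of whose `d`-subsets are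
circuits. -/
def IsClique (C : Clutter α) (d : ℕ) (W : Finset α) : Prop :=
  W ⊆ C.verts ∧ ∀ T ⊆ W, T.card = d → T ∈ C.circuits

/-- The set `SC(C)` of submaximal circuits of a `d`-uniform clutter: the `(d-1)`-sets of vertices
contained in some circuit. -/
def submaximal (C : Clutter α) (d : ℕ) : Set (Finset α) :=
  {e | e.card + 1 = d ∧ ∃ F ∈ C.circuits, e ⊆ F}

variable [DecidableEq α]

/-- The circuits of the complement of a `d`-uniform clutter: the `d`-sets of vertices which are not
circuits. -/
def complCircuits (C : Clutter α) (d : ℕ) : Finset (Finset α) :=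
  C.verts.powersetCard d \ C.circuits

/-- The circuit ideal of a `d`-uniform clutter `C` over the field `K`: the ideal of
`K[x_v : v ∈ V(C)]` generated by the monomials `∏_{v ∈ T} x_v`, where `T` runs over the circuits of
the complement of `C`. -/
def circuitIdeal (K : Type*) [Field K] (C : Clutter α) (d : ℕ) :
    Ideal (MvPolynomial C.verts K) :=
  Ideal.span ((fun T : Finset α =>
    ∏ v ∈ T.subtype (· ∈ C.verts), (MvPolynomial.X v : MvPolynomial C.verts K)) ''
      (C.complCircuits d : Set (Finset α)))

/-- `C = C₁ ⊎ C₂` for `d`-uniform clutters: `C₁` and `C₂` live on sets of vertices of `C`, the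
circuits of `C` are those of `C₁` and those of `C₂`, and either `V(C₁) ∩ V(C₂)` is a clique (of
both `C₁` and `C₂`) or `SC(C₁) ∩ SC(C₂) = ∅`. It is not required that `C₁` and `C₂` differ
from `C`. -/
structure IsDecomposition (d : ℕ) (C C₁ C₂ : Clutter α) : Prop where
  uniform : C.IsUniform d
  verts_left : C₁.verts ⊆ C.verts
  verts_right : C₂.verts ⊆ C.verts
  circuits_eq : C.circuits = C₁.circuits ∪ C₂.circuits
  glue : (C₁.IsClique d (C₁.verts ∩ C₂.verts) ∧ C₂.IsClique d (C₁.verts ∩ C₂.verts)) ∨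
    C₁.submaximal d ∩ C₂.submaximal d = ∅

end Clutter

end Clutters

/-!
By Hochster's formula the graded Betti number `β_{i,j}(I)` of the circuit ideal `I` of `C` is the
sum, over the vertex sets `W` with `|W| = j`, of the dimensions of the reduced cohomology in dimension
`j - i - 2` of the complex of cliques of `C` contained in `W`. For `j - i > d` only faces with at
least `d - 1` elements matter. On the faces with at least `d` elements the clique complex of `C` is
the union of those of `C₁` and `C₂`, and these meet in a simplex (if the common vertices form a
clique) or do not even share subfaces with `d - 1` elements (if no submaximal circuit is shared);
the case `d = 1` is apart, as all these complexes are then simplices. So the cohomology for `W` is the direct sum of those of `C₁` on `W ∩ V(C₁)` and of `C₂` on `W ∩ V(C₂)`,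
see `Clutter.IsDecomposition.finrank_cohomology`. Summing over the `W` inside `V(C₁)`, respectively
`V(C₂)`, gives the inequality of Betti numbers. Conversely a nonzero Betti number of `C` produces
one of `C₁` or `C₂` with the same `j - i`. As a nonzero circuit ideal is generated in degree `d`,
this determines the regularity.

Hochster's formula is `IsStanleyReisner.gradedBetti_eq_sum`. In the multidegree of a squarefree
monomial `∏_{v ∈ W} x_v`, the Koszul complex of `S` is the cochain complex of the simplex on `W`,
and that of `I` is the subcomplex of the cochains vanishing on the faces of the complex; the
isomorphism is the connecting homomorphism. The Koszul homology in the remaining multidegrees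
vanishes by a contracting homotopy.
-/

/-! ### Simplicial cochains -/

section Cochains

variable (K : Type*) [Field K] {α : Type*} [LinearOrder α]

/-- The incidence number `(-1) ^ #{u ∈ F | u < v}`. -/
def faceSign (v : α) (F : Finset α) : K :=
  (-1) ^ (F.filter (fun u => u < v)).card

/-- The simplicial coboundary on functions on the finite subsets of `α`. A face is indexed by its
vertex set, so the empty face is included and the cohomology is reduced. -/
def coboundary : (Finset α → K) →ₗ[K] (Finset α → K) :=
  LinearMap.pi fun G => ∑ v ∈ G, faceSign K v G • LinearMap.proj (G.erase v)

/-- The cocycles on the `t`-element faces of `Δ`. A cochain is a function on all finite sets; only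
its values on the faces with `t` elements matter. -/
def cocycles (Δ : Set (Finset α)) (t : ℕ) : Submodule K (Finset α → K) where
  carrier := {f | ∀ G ∈ Δ, G.card = t + 1 → coboundary K f G = 0}
  add_mem' {f g} hf hg G hG ht := by
    rw [map_add, Pi.add_apply, hf G hG ht, hg G hG ht, add_zero]
  zero_mem' G _ _ := by rw [map_zero, Pi.zero_apply]
  smul_mem' a f hf G hG ht := by rw [map_smul, Pi.smul_apply, hf G hG ht, smul_zero]

/-- The functions which agree with a coboundary on the `t`-element faces of `Δ`. They include the
functions vanishing on these faces. -/
def coboundaries (Δ : Set (Finset α)) (t : ℕ) : Submodule K (Finset α → K) where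
  carrier := {f | ∃ g, ∀ F ∈ Δ, F.card = t → f F = coboundary K g F}
  add_mem' := by
    rintro f f' ⟨g, hg⟩ ⟨g', hg'⟩
    exact ⟨g + g', fun F hF ht => by
      rw [map_add, Pi.add_apply, Pi.add_apply, hg F hF ht, hg' F hF ht]⟩
  zero_mem' := ⟨0, fun F _ _ => by rw [map_zero]⟩
  smul_mem' := by
    rintro a f ⟨g, hg⟩
    exact ⟨a • g, fun F hF ht => by rw [map_smul, Pi.smul_apply, Pi.smul_apply, hg F hF ht]⟩

/-- The reduced cohomology of the simplicial complex `Δ` in dimension `t - 1`, that is, on the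
faces with `t` elements. -/
abbrev Cohomology (Δ : Set (Finset α)) (t : ℕ) : Type _ :=
  cocycles K Δ t ⧸ (coboundaries K Δ t).submoduleOf (cocycles K Δ t)

variable {K}

theorem coboundary_apply (f : Finset α → K) (G : Finset α) :
    coboundary K f G = ∑ v ∈ G, faceSign K v G * f (G.erase v) := by
  simp [coboundary]

variable (K) in
theorem faceSign_mul_self (v : α) (F : Finset α) : faceSign K v F * faceSign K v F = 1 := by
  rw [faceSign, ← pow_add, Even.neg_one_pow ⟨_, rfl⟩]

variable (K) in
theorem faceSign_erase_self (v : α) (F : Finset α) :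
    faceSign K v (F.erase v) = faceSign K v F := by
  unfold faceSign
  congr 2
  ext u
  simp only [Finset.mem_filter, Finset.mem_erase]
  exact ⟨fun h => ⟨h.1.2, h.2⟩, fun h => ⟨⟨h.2.ne, h.1⟩, h.2⟩⟩

variable (K) in
theorem faceSign_insert (v w : α) (F : Finset α) (hv : v ∉ F) :
    faceSign K w (insert v F) = if v < w then -faceSign K w F else faceSign K w F := by
  unfold faceSign
  rw [Finset.filter_insert]
  split_ifs with h
  · rw [Finset.card_insert_of_notMem (by simp [hv]), pow_succ]; ring
  · rfl

variable (K) in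
theorem faceSign_swap {v w : α} {F : Finset α} (hvw : v ≠ w) (hv : v ∉ F) (hw : w ∉ F) :
    faceSign K v F * faceSign K w (insert v F) =
      -(faceSign K w F * faceSign K v (insert w F)) := by
  rw [faceSign_insert K v w F hv, faceSign_insert K w v F hw]
  rcases lt_or_gt_of_ne hvw with h | h
  · rw [if_pos h, if_neg h.not_gt]; ring
  · rw [if_neg h.not_gt, if_pos h]; ring

theorem coboundary_congr {f g : Finset α → K} {G : Finset α}
    (h : ∀ v ∈ G, f (G.erase v) = g (G.erase v)) : coboundary K f G = coboundary K g G := by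
  rw [coboundary_apply, coboundary_apply]
  exact Finset.sum_congr rfl fun v hv => by rw [h v hv]

theorem coboundary_coboundary (f : Finset α → K) : coboundary K (coboundary K f) = 0 := by
  funext G
  simp only [coboundary_apply, Finset.mul_sum, Pi.zero_apply]
  rw [Finset.sum_sigma']
  refine Finset.sum_involution (fun p _ => ⟨p.2, p.1⟩) ?_ ?_ ?_ ?_
  · rintro ⟨v, w⟩ h
    simp only [Finset.mem_sigma, Finset.mem_erase] at h
    obtain ⟨hv, hne, hw⟩ := h
    have hv' : v ∉ (G.erase v).erase w := by simp
    have hw' : w ∉ (G.erase v).erase w := by simp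
    have hs := faceSign_swap K (Ne.symm hne) hv' hw'
    have e1 : insert w ((G.erase v).erase w) = G.erase v :=
      Finset.insert_erase (Finset.mem_erase.mpr ⟨hne, hw⟩)
    have e2 : insert v ((G.erase v).erase w) = G.erase w := by
      rw [Finset.erase_right_comm]
      exact Finset.insert_erase (Finset.mem_erase.mpr ⟨Ne.symm hne, hv⟩)
    have e3 := faceSign_erase_self K w (G.erase v)
    have e4 := faceSign_erase_self K v (G.erase w)
    rw [e1, e2, faceSign_erase_self K v G, faceSign_erase_self K w G, e3,
      Finset.erase_right_comm, e4] at hs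
    dsimp only
    rw [Finset.erase_right_comm (a := w) (b := v)]
    linear_combination f ((G.erase v).erase w) * hs
  · rintro ⟨v, w⟩ h _ heq
    simp only [Finset.mem_sigma, Finset.mem_erase] at h
    simp only [Sigma.mk.injEq] at heq
    exact h.2.1 heq.1
  · rintro ⟨v, w⟩ h
    simp only [Finset.mem_sigma, Finset.mem_erase] at h ⊢
    exact ⟨h.2.2, Ne.symm h.2.1, h.1⟩
  · rintro ⟨v, w⟩ _
    rfl

/-- A full simplex is acyclic. The primitive is the cone construction over a vertex. -/
theorem exists_eq_coboundary_of_subset (V : Finset α) (t : ℕ) (f : Finset α → K)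
    (hV : V.Nonempty ∨ 1 ≤ t)
    (hf : ∀ G ⊆ V, G.card = t + 1 → coboundary K f G = 0) :
    ∃ g, ∀ F ⊆ V, F.card = t → f F = coboundary K g F := by
  rcases V.eq_empty_or_nonempty with rfl | ⟨v, hv⟩
  · have ht : 1 ≤ t := hV.resolve_left (by simp)
    refine ⟨0, fun F hF hc => ?_⟩
    rw [Finset.subset_empty.mp hF, Finset.card_empty] at hc
    omega
  refine ⟨fun E => if v ∈ E then 0 else faceSign K v E * f (insert v E), fun F hF hc => ?_⟩
  rw [coboundary_apply]
  by_cases hvF : v ∈ F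
  · rw [Finset.sum_eq_single_of_mem v hvF]
    · rw [if_neg (Finset.notMem_erase v F), Finset.insert_erase hvF, faceSign_erase_self,
        ← mul_assoc, faceSign_mul_self, one_mul]
    · intro u _ huv
      rw [if_pos (Finset.mem_erase.mpr ⟨Ne.symm huv, hvF⟩), mul_zero]
  · have h0 := hf (insert v F) (Finset.insert_subset hv hF)
      (by rw [Finset.card_insert_of_notMem hvF, hc])
    rw [coboundary_apply, Finset.sum_insert hvF, Finset.erase_insert hvF] at h0
    have hv1 : faceSign K v (insert v F) = faceSign K v F := by
      rw [← faceSign_erase_self, Finset.erase_insert hvF]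
    have h1 : f F = -(faceSign K v F * ∑ u ∈ F,
        faceSign K u (insert v F) * f ((insert v F).erase u)) := by
      have := faceSign_mul_self K v F
      rw [hv1] at h0
      linear_combination faceSign K v F * h0 - f F * this
    rw [h1, Finset.mul_sum, ← Finset.sum_neg_distrib]
    refine Finset.sum_congr rfl fun u hu => ?_
    have huv : u ≠ v := fun h => hvF (h ▸ hu)
    have hvE : v ∉ F.erase u := fun h => hvF (Finset.mem_of_mem_erase h)
    rw [if_neg hvE, Finset.erase_insert_of_ne huv.symm]
    have hs := faceSign_swap K huv.symm hvE (Finset.notMem_erase u F)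
    rw [Finset.insert_erase hu, faceSign_erase_self K u F,
      ← Finset.erase_insert_of_ne huv.symm, faceSign_erase_self] at hs
    have e1 := faceSign_mul_self K v F
    have e2 := faceSign_mul_self K v (F.erase u)
    generalize f (insert v (F.erase u)) = q
    linear_combination (-(q * faceSign K v F * faceSign K v (F.erase u))) * hs +
      q * faceSign K v F * faceSign K u (insert v F) * e2 +
      q * faceSign K u F * faceSign K v (F.erase u) * e1

end Cochains

/-! ### Dimensions of quotients and gluing of simplicial complexes -/

section Gluing

variable {K : Type*} [Field K]

theorem Submodule.finrank_quotient_submoduleOf_eq {M Q : Type*} [AddCommGroup M] [Module K M]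
    [AddCommGroup Q] [Module K Q] {Z B : Submodule K M} (ψ : Z →ₗ[K] Q)
    (hψ : Function.Surjective ψ) (hB : ∀ z : Z, ψ z = 0 ↔ (z : M) ∈ B) :
    Module.finrank K (Z ⧸ B.submoduleOf Z) = Module.finrank K Q := by
  have hk : B.submoduleOf Z = LinearMap.ker ψ := by
    ext z
    rw [LinearMap.mem_ker, hB]
    rfl
  rw [hk]
  exact (ψ.quotKerEquivOfSurjective hψ).finrank_eq

/-- A linear map which induces an isomorphism `Z / B → Z' / B'`. -/
theorem Submodule.finrank_quotient_submoduleOf_eq_of_map {M M' : Type*} [AddCommGroup M]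
    [Module K M] [AddCommGroup M'] [Module K M'] {Z B : Submodule K M} {Z' B' : Submodule K M'}
    (φ : M →ₗ[K] M') (hZ : ∀ z ∈ Z, φ z ∈ Z') (hB : ∀ z ∈ Z, φ z ∈ B' ↔ z ∈ B)
    (hs : ∀ z' ∈ Z', ∃ z ∈ Z, z' - φ z ∈ B') :
    Module.finrank K (Z ⧸ B.submoduleOf Z) = Module.finrank K (Z' ⧸ B'.submoduleOf Z') := by
  refine finrank_quotient_submoduleOf_eq ((B'.submoduleOf Z').mkQ ∘ₗ φ.restrict hZ) ?_ ?_
  · intro q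
    obtain ⟨⟨z', hz'⟩, rfl⟩ := (B'.submoduleOf Z').mkQ_surjective q
    obtain ⟨z, hz, h⟩ := hs z' hz'
    refine ⟨⟨z, hz⟩, ?_⟩
    rw [LinearMap.comp_apply, eq_comm, ← sub_eq_zero, ← map_sub, ← LinearMap.mem_ker,
      Submodule.ker_mkQ]
    exact h
  · rintro ⟨z, hz⟩
    rw [LinearMap.comp_apply, ← LinearMap.mem_ker, Submodule.ker_mkQ, ← hB z hz]
    rfl

theorem Submodule.finrank_quotient_pi {ι : Type*} [Fintype ι] {M : ι → Type*}
    [∀ i, AddCommGroup (M i)] [∀ i, Module K (M i)] (Z B : ∀ i, Submodule K (M i))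
    [∀ i, Module.Finite K (Z i ⧸ (B i).submoduleOf (Z i))] :
    Module.finrank K (Submodule.pi Set.univ Z ⧸
        (Submodule.pi Set.univ B).submoduleOf (Submodule.pi Set.univ Z)) =
      ∑ i, Module.finrank K (Z i ⧸ (B i).submoduleOf (Z i)) := by
  rw [← Module.finrank_pi_fintype K]
  refine finrank_quotient_submoduleOf_eq (LinearMap.pi fun i =>
    ((B i).submoduleOf (Z i)).mkQ ∘ₗ ((LinearMap.proj i).restrict
      (fun z (hz : z ∈ Submodule.pi Set.univ Z) => hz i (Set.mem_univ i)))) ?_ ?_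
  · intro q
    choose z hz using fun i => ((B i).submoduleOf (Z i)).mkQ_surjective (q i)
    refine ⟨⟨fun i => z i, fun i _ => (z i).2⟩, ?_⟩
    funext i
    exact hz i
  · rintro ⟨z, hz⟩
    rw [funext_iff, Submodule.mem_pi]
    refine forall_congr' fun i => ?_
    simp only [Set.mem_univ, forall_true_left, LinearMap.pi_apply, LinearMap.comp_apply,
      Pi.zero_apply]
    rw [← LinearMap.mem_ker, Submodule.ker_mkQ]
    rfl

variable {α : Type*} [LinearOrder α]

/-- A complex with finitely many faces has finite-dimensional cohomology. -/
theorem Cohomology.finite {Δ : Set (Finset α)} (hΔ : Δ.Finite) (t : ℕ)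
    (hlow : IsLowerSet Δ) : Module.Finite K (Cohomology K Δ t) := by
  classical
  have : Finite Δ := hΔ
  let E : (Δ → K) →ₗ[K] (Finset α → K) :=
    LinearMap.pi fun F => if h : F ∈ Δ then LinearMap.proj ⟨F, h⟩ else 0
  have hE : ∀ (f : Finset α → K), ∀ F ∈ Δ, E (fun G => f G) F = f F := by
    intro f F hF
    simp [E, hF]
  let Z := (cocycles K Δ t).comap E
  let ψ : Z →ₗ[K] Cohomology K Δ t := ((coboundaries K Δ t).submoduleOf (cocycles K Δ t)).mkQ ∘ₗ
    E.restrict (fun _ h => h)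
  refine Module.Finite.of_surjective ψ fun q => ?_
  obtain ⟨⟨f, hf⟩, rfl⟩ := Submodule.mkQ_surjective _ q
  refine ⟨⟨fun G => f G, fun G hG hc => ?_⟩, ?_⟩
  · rw [← hf G hG hc]
    exact coboundary_congr fun v _ => hE f _ (hlow (Finset.erase_subset v G) hG)
  · rw [LinearMap.comp_apply, ← sub_eq_zero, ← map_sub, ← LinearMap.mem_ker, Submodule.ker_mkQ]
    refine ⟨0, fun F hF _ => ?_⟩
    rw [map_zero]
    exact sub_eq_zero.mpr (hE f F hF)

/-- The cohomology of a full simplex vanishes, except on the empty face of an empty simplex. -/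
theorem finrank_cohomology_simplex {Δ : Set (Finset α)} {V : Finset α} {t : ℕ} (ht : 1 ≤ t)
    (hΔ : ∀ F, F ∈ Δ ↔ F ⊆ V) : Module.finrank K (Cohomology K Δ t) = 0 := by
  have : Subsingleton (Cohomology K Δ t) := by
    rw [Submodule.Quotient.subsingleton_iff, Submodule.submoduleOf_eq_top]
    intro f hf
    obtain ⟨g, hg⟩ := exists_eq_coboundary_of_subset V t f (Or.inr ht)
      (fun G hG => hf G ((hΔ G).mpr hG))
    exact ⟨g, fun F hF => hg F ((hΔ F).mp hF)⟩
  exact Module.finrank_zero_of_subsingleton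

/-- The Mayer-Vietoris argument: in a fixed degree, the cohomology of a union of two complexes
which meet in a simplex is the direct sum of their cohomologies. Only the faces with `t` or `t + 1`
elements and the `(t - 1)`-subsets of the former are involved. -/
theorem finrank_cohomology_union {Δ Δ₁ Δ₂ : Set (Finset α)} {t : ℕ} (ht : 1 ≤ t) (V : Finset α)
    (h₁ : IsLowerSet Δ₁) (h₂ : IsLowerSet Δ₂) (hf₁ : Δ₁.Finite) (hf₂ : Δ₂.Finite)
    (hΔ : ∀ F : Finset α, t ≤ F.card → (F ∈ Δ ↔ F ∈ Δ₁ ∨ F ∈ Δ₂))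
    (hV : ∀ F ⊆ V, F ∈ Δ₁ ∧ F ∈ Δ₂)
    (hface : ∀ F ∈ Δ₁, F ∈ Δ₂ → F.card = t → F ⊆ V)
    (hsub : ∀ F₁ ∈ Δ₁, ∀ F₂ ∈ Δ₂, F₁.card = t → F₂.card = t → ∀ E ⊆ F₁, E ⊆ F₂ →
      E.card + 1 = t → E ⊆ V ∧ V.Nonempty) :
    Module.finrank K (Cohomology K Δ t) =
      Module.finrank K (Cohomology K Δ₁ t) + Module.finrank K (Cohomology K Δ₂ t) := by
  classical
  have := Cohomology.finite (K := K) hf₁ t h₁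
  have := Cohomology.finite (K := K) hf₂ t h₂
  rw [← Module.finrank_prod]
  have hZ₁ : cocycles K Δ t ≤ cocycles K Δ₁ t := fun f hf G hG hc =>
    hf G ((hΔ G (by omega)).mpr (Or.inl hG)) hc
  have hZ₂ : cocycles K Δ t ≤ cocycles K Δ₂ t := fun f hf G hG hc =>
    hf G ((hΔ G (by omega)).mpr (Or.inr hG)) hc
  refine Submodule.finrank_quotient_submoduleOf_eq
    (LinearMap.prod (Submodule.mkQ _ ∘ₗ Submodule.inclusion hZ₁)
      (Submodule.mkQ _ ∘ₗ Submodule.inclusion hZ₂)) ?_ ?_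
  · rintro ⟨q₁, q₂⟩
    obtain ⟨⟨f₁, hf₁⟩, rfl⟩ := Submodule.mkQ_surjective _ q₁
    obtain ⟨⟨f₂, hf₂⟩, rfl⟩ := Submodule.mkQ_surjective _ q₂
    -- Both cocycles are normalized to vanish on the common simplex; then they can be glued.
    obtain ⟨g₁, hg₁⟩ := exists_eq_coboundary_of_subset V t f₁ (Or.inr ht)
      (fun G hG => hf₁ G (hV G hG).1)
    obtain ⟨g₂, hg₂⟩ := exists_eq_coboundary_of_subset V t f₂ (Or.inr ht)
      (fun G hG => hf₂ G (hV G hG).2)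
    let f : Finset α → K := fun F =>
      if F ∈ Δ₁ then f₁ F - coboundary K g₁ F else f₂ F - coboundary K g₂ F
    have e₁ : ∀ F ∈ Δ₁, f F = f₁ F - coboundary K g₁ F := fun F hF => if_pos hF
    have e₂ : ∀ F ∈ Δ₂, F.card = t → f F = f₂ F - coboundary K g₂ F := by
      intro F hF hc
      by_cases hF₁ : F ∈ Δ₁
      · have hFV := hface F hF₁ hF hc
        rw [e₁ F hF₁, hg₁ F hFV hc, hg₂ F hFV hc, sub_self, sub_self]
      · exact if_neg hF₁
    have hf : f ∈ cocycles K Δ t := by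
      intro G hG hc
      have hce : ∀ v ∈ G, (G.erase v).card = t := fun v hv => by
        rw [Finset.card_erase_of_mem hv, hc, Nat.add_sub_cancel]
      rcases (hΔ G (by omega)).mp hG with hG | hG
      · rw [coboundary_congr (g := f₁ - coboundary K g₁)
          fun v _ => e₁ _ (h₁ (Finset.erase_subset v G) hG), map_sub, coboundary_coboundary,
          sub_zero, hf₁ G hG hc]
      · rw [coboundary_congr (g := f₂ - coboundary K g₂)
          fun v hv => e₂ _ (h₂ (Finset.erase_subset v G) hG) (hce v hv), map_sub,
          coboundary_coboundary, sub_zero, hf₂ G hG hc]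
    refine ⟨⟨f, hf⟩, Prod.ext ?_ ?_⟩
    · refine (Submodule.Quotient.eq _).mpr ?_
      refine ⟨-g₁, fun F hF hc => ?_⟩
      change f F - f₁ F = _
      rw [e₁ F hF, map_neg, Pi.neg_apply]
      ring
    · refine (Submodule.Quotient.eq _).mpr ?_
      refine ⟨-g₂, fun F hF hc => ?_⟩
      change f F - f₂ F = _
      rw [e₂ F hF hc, map_neg, Pi.neg_apply]
      ring
  · rintro ⟨f, hf⟩
    rw [LinearMap.prod_apply, Function.prod_apply, Prod.mk_eq_zero, LinearMap.comp_apply,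
      LinearMap.comp_apply,
      ← LinearMap.mem_ker, ← LinearMap.mem_ker, Submodule.ker_mkQ, Submodule.ker_mkQ]
    constructor
    · rintro ⟨⟨g₁, hg₁⟩, ⟨g₂, hg₂⟩⟩
      replace hg₁ : ∀ F ∈ Δ₁, F.card = t → f F = coboundary K g₁ F := hg₁
      replace hg₂ : ∀ F ∈ Δ₂, F.card = t → f F = coboundary K g₂ F := hg₂
      -- The two primitives differ by a cocycle on the common simplex, hence by a coboundary there.
      obtain ⟨k, hk⟩ : ∃ k, V.Nonempty → ∀ E ⊆ V, E.card = t - 1 →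
          (g₁ - g₂) E = coboundary K k E := by
        by_cases hne : V.Nonempty
        · obtain ⟨k, hk⟩ := exists_eq_coboundary_of_subset V (t - 1) (g₁ - g₂) (Or.inl hne)
            (fun G hG hc => by
              have hc' : G.card = t := by omega
              rw [map_sub, Pi.sub_apply, ← hg₁ G (hV G hG).1 hc', ← hg₂ G (hV G hG).2 hc',
                sub_self])
          exact ⟨k, fun _ => hk⟩
        · exact ⟨0, fun h => absurd h hne⟩
      let g : Finset α → K := fun E =>
        if ∃ F ∈ Δ₁, F.card = t ∧ E ⊆ F then g₁ E else g₂ E + coboundary K k E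
      refine ⟨g, fun F hF hc => ?_⟩
      have hce : ∀ v ∈ F, (F.erase v).card = t - 1 := fun v hv => by
        rw [Finset.card_erase_of_mem hv, hc]
      change f F = _
      rcases (hΔ F hc.ge).mp hF with hF | hF
      · rw [hg₁ F hF hc]
        exact coboundary_congr fun v _ => (if_pos ⟨F, hF, hc, Finset.erase_subset v F⟩).symm
      · rw [hg₂ F hF hc, coboundary_congr (f := g) (g := g₂ + coboundary K k), map_add,
          coboundary_coboundary, add_zero]
        intro v hv
        by_cases h : ∃ F' ∈ Δ₁, F'.card = t ∧ F.erase v ⊆ F'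
        · obtain ⟨F', hF', hc', hsubF⟩ := h
          obtain ⟨hEV, hne⟩ := hsub F' hF' F hF hc' hc _ hsubF (Finset.erase_subset v F)
            (by rw [hce v hv]; omega)
          have := hk hne _ hEV (hce v hv)
          rw [Pi.add_apply, ← this, Pi.sub_apply]
          change (if _ then _ else _) = _
          rw [if_pos ⟨F', hF', hc', hsubF⟩]
          ring
        · exact if_neg h
    · rintro ⟨g, hg⟩
      exact ⟨⟨g, fun F hF hc => hg F ((hΔ F hc.ge).mpr (Or.inl hF)) hc⟩,
        ⟨g, fun F hF hc => hg F ((hΔ F hc.ge).mpr (Or.inr hF)) hc⟩⟩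

/-- Cohomology is invariant under order-preserving relabelling of the vertices. -/
theorem finrank_cohomology_map {σ : Type*} [LinearOrder σ] (e : σ ↪o α) {Δ : Set (Finset σ)}
    {Δ' : Set (Finset α)} (hΔ : ∀ F', F' ∈ Δ' ↔ ∃ F ∈ Δ, F.map e.toEmbedding = F') (t : ℕ) :
    Module.finrank K (Cohomology K Δ' t) = Module.finrank K (Cohomology K Δ t) := by
  let φ : (Finset α → K) →ₗ[K] (Finset σ → K) :=
    LinearMap.funLeft K K (fun F => F.map e.toEmbedding)
  have hφ : Function.Surjective φ :=
    LinearMap.funLeft_surjective_of_injective K K _ (Finset.map_injective e.toEmbedding)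
  have hcob : ∀ f G, coboundary K (φ f) G = coboundary K f (G.map e.toEmbedding) := by
    intro f G
    rw [coboundary_apply, coboundary_apply, Finset.sum_map]
    refine Finset.sum_congr rfl fun v _ => ?_
    congr 1
    · unfold faceSign
      rw [Finset.filter_map, Finset.card_map]
      congr 3
      ext u
      simp
    · exact congrArg f (Finset.map_erase _ _ _)
  refine Submodule.finrank_quotient_submoduleOf_eq_of_map φ ?_ ?_ ?_
  · intro f hf G hG hc
    rw [hcob]
    exact hf _ ((hΔ _).mpr ⟨G, hG, rfl⟩) (by rw [Finset.card_map, hc])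
  · intro f _
    constructor
    · rintro ⟨g, hg⟩
      obtain ⟨g, rfl⟩ := hφ g
      refine ⟨g, fun F' hF' hc => ?_⟩
      obtain ⟨F, hF, rfl⟩ := (hΔ F').mp hF'
      rw [← hcob, ← hg F hF (by rw [← hc, Finset.card_map])]
      rfl
    · rintro ⟨g, hg⟩
      refine ⟨φ g, fun F hF hc => ?_⟩
      rw [hcob, ← hg _ ((hΔ _).mpr ⟨F, hF, rfl⟩) (by rw [Finset.card_map, hc])]
      rfl
  · intro f hf
    obtain ⟨f, rfl⟩ := hφ f
    refine ⟨f, fun G' hG' hc => ?_, by rw [sub_self]; exact Submodule.zero_mem _⟩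
    obtain ⟨G, hG, rfl⟩ := (hΔ G').mp hG'
    rw [← hcob]
    exact hf G hG (by rw [← hc, Finset.card_map])

end Gluing

/-! ### Koszul homology of squarefree monomial ideals -/

noncomputable section Hochster

set_option linter.unusedSectionVars false

open MvPolynomial

variable {K : Type*} [Field K] {σ : Type*} [LinearOrder σ]

/-- The exponent of the squarefree monomial `∏_{v ∈ F} x_v`. -/
def squarefreeExp (F : Finset σ) : σ →₀ ℕ := Finsupp.indicator F fun _ _ => 1

theorem squarefreeExp_apply (F : Finset σ) (v : σ) :
    squarefreeExp F v = if v ∈ F then 1 else 0 := by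
  simp [squarefreeExp, Finsupp.indicator_apply]

theorem support_squarefreeExp (F : Finset σ) : (squarefreeExp F).support = F := by
  ext v
  simp [squarefreeExp_apply]

theorem squarefreeExp_injective : Function.Injective (squarefreeExp (σ := σ)) := fun F G h => by
  rw [← support_squarefreeExp F, h, support_squarefreeExp]

theorem degree_squarefreeExp (F : Finset σ) : (squarefreeExp F).degree = F.card := by
  rw [Finsupp.degree_apply, support_squarefreeExp, Finset.card_eq_sum_ones]
  exact Finset.sum_congr rfl fun v hv => by rw [squarefreeExp_apply, if_pos hv]

theorem squarefreeExp_erase {F : Finset σ} {v : σ} (hv : v ∈ F) :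
    Finsupp.single v 1 + squarefreeExp (F.erase v) = squarefreeExp F := by
  ext u
  rw [Finsupp.add_apply, squarefreeExp_apply, squarefreeExp_apply, Finsupp.single_apply]
  by_cases h : v = u
  · subst h; simp [hv]
  · simp [h, Ne.symm h]

theorem monomial_squarefreeExp (F : Finset σ) :
    monomial (squarefreeExp F) (1 : K) = ∏ v ∈ F, X v := by
  induction F using Finset.induction_on with
  | empty =>
    have : squarefreeExp (∅ : Finset σ) = 0 := by ext; simp [squarefreeExp_apply]
    rw [this, Finset.prod_empty]
    rfl
  | insert v F hv ih =>
    rw [Finset.prod_insert hv, ← ih, ← squarefreeExp_erase (Finset.mem_insert_self v F),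
      Finset.erase_insert hv, X, monomial_mul, one_mul]

variable (K) in
/-- The sign relating the Koszul basis vector `e_{W \ F}` to the face `F` of the simplex on `W`. -/
def complSign (W F : Finset σ) : K := ∏ u ∈ F, faceSign K u W

variable (K) in
theorem complSign_mul_self (W F : Finset σ) : complSign K W F * complSign K W F = 1 := by
  rw [complSign, ← Finset.prod_mul_distrib]
  exact Finset.prod_eq_one fun u _ => faceSign_mul_self K u W

variable (K) in
theorem complSign_mul_faceSign {W G : Finset σ} {v : σ} (hG : G ⊆ W) (hv : v ∈ G) :
    complSign K W G * faceSign K v G =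
      complSign K W (G.erase v) * faceSign K v (W \ G) := by
  have h1 : complSign K W G = faceSign K v W * complSign K W (G.erase v) :=
    (Finset.mul_prod_erase G _ hv).symm
  have h2 : faceSign K v W = faceSign K v (W \ G) * faceSign K v G := by
    unfold faceSign
    rw [← pow_add, ← Finset.card_union_of_disjoint
      (Finset.disjoint_filter_filter Finset.sdiff_disjoint), ← Finset.filter_union,
      Finset.sdiff_union_of_subset hG]
  rw [h1, h2]
  linear_combination (faceSign K v (W \ G) * complSign K W (G.erase v)) * faceSign_mul_self K v G

/-- The part of multidegree `W` of a Koszul chain, as a cochain on the simplex on `W`. -/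
def multidegreePart (W : Finset σ) (c : Finset σ → MvPolynomial σ K) : Finset σ → K := fun F =>
  complSign K W F * coeff (squarefreeExp F) (c (W \ F))

theorem multidegreePart_sub (W : Finset σ) (c c' : Finset σ → MvPolynomial σ K) :
    multidegreePart W (c - c') = multidegreePart W c - multidegreePart W c' := by
  funext F
  simp only [multidegreePart, Pi.sub_apply, coeff_sub, mul_sub]

/-- The Koszul chain of homological degree `i` whose part of multidegree `W` is given by the
cochain `f W` for every `W ∈ P`. -/
def koszulChain (P : Finset (Finset σ)) (i : ℕ) :
    (P → Finset σ → K) →ₗ[K] (Finset σ → MvPolynomial σ K) where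
  toFun f A := if A.card = i then ∑ W : P, if A ⊆ W then
    monomial (squarefreeExp (W.1 \ A)) (complSign K W.1 (W.1 \ A) * f W (W.1 \ A)) else 0 else 0
  map_add' f g := by
    funext A
    simp only [Pi.add_apply]
    split_ifs with h
    · rw [← Finset.sum_add_distrib]
      refine Finset.sum_congr rfl fun W _ => ?_
      split_ifs
      · rw [mul_add, map_add]
      · rw [add_zero]
    · rw [add_zero]
  map_smul' a f := by
    funext A
    simp only [Pi.smul_apply, smul_eq_mul, RingHom.id_apply]
    split_ifs with h
    · rw [Finset.smul_sum]
      refine Finset.sum_congr rfl fun W _ => ?_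
      split_ifs
      · rw [mul_left_comm, ← smul_eq_mul, map_smul]
      · rw [smul_zero]
    · rw [smul_zero]

theorem koszulChain_apply (P : Finset (Finset σ)) (i : ℕ) (f : P → Finset σ → K)
    (A : Finset σ) :
    koszulChain P i f A = if A.card = i then ∑ W : P, if A ⊆ W then
      monomial (squarefreeExp (W.1 \ A)) (complSign K W.1 (W.1 \ A) * f W (W.1 \ A))
      else 0 else 0 := rfl

theorem coeff_koszulChain_ne_zero {P : Finset (Finset σ)} {i : ℕ} {f : P → Finset σ → K}
    {A : Finset σ} {m : σ →₀ ℕ} (h : coeff m (koszulChain P i f A) ≠ 0) :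
    A.card = i ∧ ∃ W : P, A ⊆ W ∧ m = squarefreeExp (W.1 \ A) ∧ f W (W.1 \ A) ≠ 0 := by
  rw [koszulChain_apply] at h
  split_ifs at h with hA
  · rw [coeff_sum] at h
    obtain ⟨W, -, hW⟩ := Finset.exists_ne_zero_of_sum_ne_zero h
    split_ifs at hW with hAW
    · rw [coeff_monomial] at hW
      split_ifs at hW with hm
      · exact ⟨hA, W, hAW, hm.symm, right_ne_zero_of_mul hW⟩
      · exact absurd rfl hW
    · exact absurd (coeff_zero m) hW
  · exact absurd (coeff_zero m) h

theorem multidegreePart_koszulChain {P : Finset (Finset σ)} {i : ℕ} (f : P → Finset σ → K)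
    (W : P) {F : Finset σ} (hF : F ⊆ W) (hc : (W.1 \ F).card = i) :
    multidegreePart W (koszulChain P i f) F = f W F := by
  have hs : W.1 \ (W.1 \ F) = F := Finset.sdiff_sdiff_eq_self hF
  rw [multidegreePart, koszulChain_apply, if_pos hc, coeff_sum, Finset.sum_eq_single W]
  · rw [if_pos Finset.sdiff_subset, hs, coeff_monomial, if_pos rfl, ← mul_assoc,
      complSign_mul_self, one_mul]
  · intro W' _ hne
    split_ifs with hsub
    · rw [coeff_monomial, if_neg]
      intro heq
      refine hne (Subtype.ext ?_)
      rw [← Finset.sdiff_union_of_subset hsub, squarefreeExp_injective heq,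
        Finset.union_sdiff_of_subset hF]
    · exact coeff_zero _
  · exact fun h => absurd (Finset.mem_univ W) h

variable [Fintype σ]

variable (K) in
theorem koszulSign_eq_C (v : σ) (B : Finset σ) : koszulSign K v B = C (faceSign K v B) := by
  simp [koszulSign, faceSign]

theorem coeff_koszulD (c : Finset σ → MvPolynomial σ K) (B : Finset σ) (m : σ →₀ ℕ) :
    coeff m (koszulD K c B) = ∑ v ∈ Bᶜ, faceSign K v B *
      if v ∈ m.support then coeff (m - Finsupp.single v 1) (c (insert v B)) else 0 := by
  rw [koszulD_apply, coeff_sum]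
  refine Finset.sum_congr rfl fun v _ => ?_
  rw [koszulSign_eq_C, mul_assoc, coeff_C_mul, coeff_X_mul']

/-- In a squarefree multidegree the Koszul differential is the simplicial coboundary. -/
theorem multidegreePart_koszulD (c : Finset σ → MvPolynomial σ K) {W G : Finset σ} (hG : G ⊆ W) :
    multidegreePart W (koszulD K c) G = coboundary K (multidegreePart W c) G := by
  rw [multidegreePart, coeff_koszulD, coboundary_apply, Finset.mul_sum]
  have hsub : G ⊆ (W \ G)ᶜ := fun v hv => by simp [hv]
  rw [← Finset.sum_subset hsub]
  · refine Finset.sum_congr rfl fun v hv => ?_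
    have h1 : insert v (W \ G) = W \ G.erase v := by
      rw [Finset.sdiff_erase (hG hv)]
    rw [support_squarefreeExp, if_pos hv, h1, multidegreePart, ← squarefreeExp_erase hv,
      add_tsub_cancel_left]
    have hs := complSign_mul_faceSign K hG hv
    have e1 := faceSign_mul_self K v G
    have e2 := faceSign_mul_self K v (W \ G)
    generalize coeff (squarefreeExp (G.erase v)) (c (W \ G.erase v)) = q
    linear_combination (faceSign K v (W \ G) * faceSign K v G * q) * hs -
      (complSign K W G * faceSign K v (W \ G) * q) * e1 +
      (complSign K W (G.erase v) * faceSign K v G * q) * e2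
  · intro v _ hv
    rw [support_squarefreeExp, if_neg hv, mul_zero, mul_zero]

theorem koszulD_koszulChain (P : Finset (Finset σ)) (i : ℕ) (f : P → Finset σ → K) :
    koszulD K (koszulChain P (i + 1) f) = koszulChain P i (fun W => coboundary K (f W)) := by
  funext B
  rw [koszulD_apply, koszulChain_apply]
  split_ifs with hB
  · have : ∀ v ∈ Bᶜ, koszulSign K v B * X v * koszulChain P (i + 1) f (insert v B) =
        ∑ W : P, if insert v B ⊆ W then monomial (squarefreeExp (W.1 \ B))
          (faceSign K v B * (complSign K W.1 ((W.1 \ B).erase v) * f W ((W.1 \ B).erase v)))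
          else 0 := by
      intro v hv
      have hvB : v ∉ B := by simpa using hv
      rw [koszulChain_apply, if_pos (by rw [Finset.card_insert_of_notMem hvB, hB]),
        Finset.mul_sum]
      refine Finset.sum_congr rfl fun W _ => ?_
      split_ifs with hW
      · have hvW : v ∈ W.1 \ B :=
          Finset.mem_sdiff.mpr ⟨hW (Finset.mem_insert_self v B), hvB⟩
        rw [Finset.sdiff_insert, ← squarefreeExp_erase hvW, koszulSign_eq_C, mul_assoc,
          X, monomial_mul, C_mul_monomial, one_mul]
      · rw [mul_zero]
    rw [Finset.sum_congr rfl this, Finset.sum_comm]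
    refine Finset.sum_congr rfl fun W _ => ?_
    split_ifs with hBW
    · have hsub : W.1 \ B ⊆ Bᶜ := fun v hv => by
        simpa using (Finset.mem_sdiff.mp hv).2
      rw [← Finset.sum_subset hsub, coboundary_apply, Finset.mul_sum, map_sum]
      · refine Finset.sum_congr rfl fun v hv => ?_
        rw [if_pos (Finset.insert_subset (Finset.mem_sdiff.mp hv).1 hBW)]
        congr 1
        have hs := complSign_mul_faceSign K (Finset.sdiff_subset (s := W.1) (t := B)) hv
        rw [Finset.sdiff_sdiff_eq_self hBW] at hs
        linear_combination (-f W ((W.1 \ B).erase v)) * hs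
      · intro v hv hvW
        refine if_neg fun h => hvW (Finset.mem_sdiff.mpr
          ⟨h (Finset.mem_insert_self v B), by simpa using hv⟩)
    · exact Finset.sum_eq_zero fun v _ => if_neg fun h =>
        hBW ((Finset.subset_insert v B).trans h)
  · refine Finset.sum_eq_zero fun v hv => ?_
    have hvB : v ∉ B := by simpa using hv
    rw [koszulChain_apply, if_neg, mul_zero]
    rw [Finset.card_insert_of_notMem hvB]
    omega

/-- `I` is the Stanley-Reisner ideal of `Δ`: a polynomial belongs to `I` if and only if none of its
monomials is supported on a face of `Δ`. -/
structure IsStanleyReisner (I : Ideal (MvPolynomial σ K)) (Δ : Set (Finset σ)) : Prop where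
  isLowerSet : IsLowerSet Δ
  mem_iff : ∀ p, p ∈ I ↔ ∀ m, coeff m p ≠ 0 → m.support ∉ Δ

namespace IsStanleyReisner

variable {I : Ideal (MvPolynomial σ K)} {Δ : Set (Finset σ)}

theorem mem_koszulStrand_iff (hI : IsStanleyReisner I Δ) {i j : ℕ}
    {c : Finset σ → MvPolynomial σ K} :
    c ∈ koszulStrand I i j ↔ ∀ A m, coeff m (c A) ≠ 0 →
      A.card = i ∧ i ≤ j ∧ m.degree = j - i ∧ m.support ∉ Δ := by
  rw [koszulStrand, Submodule.mem_pi]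
  refine forall_congr' fun A => ?_
  simp only [Set.mem_univ, forall_true_left]
  split_ifs with hA
  · rw [Submodule.mem_inf, Submodule.restrictScalars_mem, hI.mem_iff, mem_homogeneousSubmodule]
    constructor
    · rintro ⟨h1, h2⟩ m hm
      refine ⟨hA.1, hA.2, ?_, h1 m hm⟩
      by_contra hne
      exact hm (h2.coeff_eq_zero hne)
    · intro h
      refine ⟨fun m hm => (h m hm).2.2.2, fun m hm => ?_⟩
      rw [← (h m hm).2.2.1, Finsupp.degree_eq_weight_one]
      rfl
  · rw [Submodule.mem_bot]
    constructor
    · intro h m hm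
      rw [h, coeff_zero] at hm
      exact absurd rfl hm
    · intro h
      ext m
      by_contra hm
      exact hA ⟨(h m hm).1, (h m hm).2.1⟩

theorem koszulChain_mem (hI : IsStanleyReisner I Δ) {i j : ℕ}
    {f : ↥((Finset.univ : Finset σ).powersetCard j) → Finset σ → K}
    (hf : ∀ W, ∀ F ∈ Δ, F ⊆ W.1 → F.card + i = j → f W F = 0) :
    koszulChain _ i f ∈ koszulStrand I i j := by
  rw [hI.mem_koszulStrand_iff]
  intro A m hm
  obtain ⟨hA, W, hAW, rfl, hne⟩ := coeff_koszulChain_ne_zero hm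
  have hW : W.1.card = j := (Finset.mem_powersetCard.mp W.2).2
  have h1 := Finset.card_sdiff_add_card_eq_card hAW
  rw [degree_squarefreeExp, support_squarefreeExp]
  exact ⟨hA, by omega, by omega, fun h => hne (hf W _ h Finset.sdiff_subset (by omega))⟩

/-- The multidegrees `μ` for which `v` is the first variable with `2 ≤ μ v`. -/
def FirstSquare (v : σ) (μ : σ →₀ ℕ) : Prop := 2 ≤ μ v ∧ ∀ u < v, μ u < 2

open Classical in
/-- The part of a Koszul chain in the multidegrees where `v` is the first variable with exponent at
least two; the term `x^m e_A` has multidegree `m + 1_A`. -/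
def firstSquarePart (v : σ) (c : Finset σ → MvPolynomial σ K) : Finset σ → MvPolynomial σ K :=
  fun A => ∑ m ∈ (c A).support,
    if FirstSquare v (m + squarefreeExp A) then monomial m (coeff m (c A)) else 0

open Classical in
theorem coeff_firstSquarePart (v : σ) (c : Finset σ → MvPolynomial σ K) (A : Finset σ)
    (m : σ →₀ ℕ) : coeff m (firstSquarePart v c A) =
      if FirstSquare v (m + squarefreeExp A) then coeff m (c A) else 0 := by
  rw [firstSquarePart, coeff_sum]
  by_cases hm : m ∈ (c A).support
  · rw [Finset.sum_eq_single_of_mem m hm]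
    · split_ifs
      · rw [coeff_monomial, if_pos rfl]
      · rw [coeff_zero]
    · intro m' _ hne
      split_ifs
      · rw [coeff_monomial, if_neg hne]
      · rw [coeff_zero]
  · rw [notMem_support_iff.mp hm, ite_self]
    refine Finset.sum_eq_zero fun m' hm' => ?_
    split_ifs
    · rw [coeff_monomial, if_neg]
      rintro rfl
      exact hm hm'
    · rw [coeff_zero]

theorem koszulD_firstSquarePart (v : σ) (c : Finset σ → MvPolynomial σ K) :
    koszulD K (firstSquarePart v c) = firstSquarePart v (koszulD K c) := by
  classical
  funext B
  ext m
  -- The differential preserves the multidegree.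
  have key : ∀ u ∈ Bᶜ, u ∈ m.support →
      m - Finsupp.single u 1 + squarefreeExp (insert u B) = m + squarefreeExp B := by
    intro u hu hum
    have huB : u ∉ B := by simpa using hu
    rw [← squarefreeExp_erase (Finset.mem_insert_self u B), Finset.erase_insert huB, ← add_assoc,
      tsub_add_cancel_of_le]
    rw [Finsupp.single_le_iff]
    exact Nat.one_le_iff_ne_zero.mpr (Finsupp.mem_support_iff.mp hum)
  have hterm : ∀ u ∈ Bᶜ, (faceSign K u B * if u ∈ m.support then
        coeff (m - Finsupp.single u 1) (firstSquarePart v c (insert u B)) else 0) =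
      if FirstSquare v (m + squarefreeExp B) then faceSign K u B * if u ∈ m.support then
        coeff (m - Finsupp.single u 1) (c (insert u B)) else 0 else 0 := by
    intro u hu
    by_cases hum : u ∈ m.support
    · rw [if_pos hum, if_pos hum, coeff_firstSquarePart, key u hu hum, mul_ite, mul_zero]
    · rw [if_neg hum, if_neg hum, mul_zero, ite_self]
  rw [coeff_firstSquarePart, coeff_koszulD, coeff_koszulD, Finset.sum_congr rfl hterm]
  split_ifs
  · rfl
  · exact Finset.sum_const_zero

theorem sum_firstSquarePart {c : Finset σ → MvPolynomial σ K}
    (hc : ∀ W, ∀ F ⊆ W, multidegreePart W c F = 0) : ∑ v, firstSquarePart v c = c := by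
  classical
  funext A
  ext m
  rw [Finset.sum_apply, coeff_sum]
  simp only [coeff_firstSquarePart]
  by_cases hs : ∀ v, (m + squarefreeExp A) v < 2
  · have hm : m = squarefreeExp m.support := by
      ext v
      have := hs v
      rw [Finsupp.add_apply] at this
      rw [squarefreeExp_apply]
      split_ifs with hv
      · rw [Finsupp.mem_support_iff] at hv
        omega
      · simpa using hv
    have hd : Disjoint m.support A := by
      rw [Finset.disjoint_left]
      intro v hv hvA
      have := hs v
      rw [Finsupp.add_apply, squarefreeExp_apply, if_pos hvA] at this
      rw [Finsupp.mem_support_iff] at hv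
      omega
    have h0 := hc (m.support ∪ A) m.support Finset.subset_union_left
    rw [multidegreePart, Finset.union_sdiff_cancel_left hd, ← hm] at h0
    have hne : complSign K (m.support ∪ A) m.support ≠ 0 := fun h => by
      have := complSign_mul_self K (m.support ∪ A) m.support
      rw [h, mul_zero] at this
      exact zero_ne_one this
    rw [(mul_eq_zero.mp h0).resolve_left hne]
    exact Finset.sum_eq_zero fun v _ => ite_self _
  · push Not at hs
    obtain ⟨v₀, hv₀⟩ := hs
    let S := Finset.univ.filter fun v => 2 ≤ (m + squarefreeExp A) v
    have hS : S.Nonempty := ⟨v₀, Finset.mem_filter.mpr ⟨Finset.mem_univ _, hv₀⟩⟩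
    have hmin : FirstSquare (S.min' hS) (m + squarefreeExp A) := by
      refine ⟨(Finset.mem_filter.mp (S.min'_mem hS)).2, fun u hu => ?_⟩
      by_contra h
      exact (S.min'_le u (Finset.mem_filter.mpr ⟨Finset.mem_univ _, not_lt.mp h⟩)).not_gt hu
    rw [Finset.sum_eq_single (S.min' hS), if_pos hmin]
    · intro u _ hu
      rw [if_neg]
      intro h
      rcases lt_or_gt_of_ne hu with hlt | hgt
      · exact absurd h.1 (by have := hmin.2 u hlt; omega)
      · exact absurd hmin.1 (by have := h.2 _ hgt; omega)
    · exact fun h => absurd (Finset.mem_univ _) h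

/-- The Koszul homology of a Stanley-Reisner ideal vanishes in the multidegrees which are not
squarefree. If the exponent of `x_v` is at least two, then division by `x_v` does not change the
support of a monomial without `e_v`, so the contraction in the direction of `v` preserves the
ideal. -/
theorem mem_koszulBoundaries (hI : IsStanleyReisner I Δ) {i j : ℕ}
    {c : Finset σ → MvPolynomial σ K} (hc : c ∈ koszulCycles I i j)
    (h0 : ∀ W, ∀ F ⊆ W, multidegreePart W c F = 0) : c ∈ koszulBoundaries I i j := by
  classical
  have hstrand := hI.mem_koszulStrand_iff.mp hc.1
  have hD : koszulD K c = 0 := hc.2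
  rw [← sum_firstSquarePart h0]
  refine Submodule.sum_mem _ fun v _ => ?_
  have hDv : koszulD K (firstSquarePart v c) = 0 := by
    rw [koszulD_firstSquarePart, hD]
    funext A
    simp [firstSquarePart]
  refine ⟨koszulH K v (firstSquarePart v c), ?_, ?_⟩
  · refine hI.mem_koszulStrand_iff.mpr fun B m hm => ?_
    rw [koszulH] at hm
    split_ifs at hm with hvB
    · rw [koszulSign_eq_C, coeff_C_mul, coeff_divMonomial, coeff_firstSquarePart] at hm
      replace hm := right_ne_zero_of_mul hm
      split_ifs at hm with hsq
      · obtain ⟨h1, h2, h3, h4⟩ := hstrand _ _ hm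
        have hv := hsq.1
        rw [Finsupp.add_apply, squarefreeExp_apply, if_neg (Finset.notMem_erase v B),
          Finsupp.add_apply, Finsupp.single_eq_same] at hv
        have hsupp : (Finsupp.single v 1 + m).support = m.support := by
          ext u
          rw [Finsupp.mem_support_iff, Finsupp.mem_support_iff, Finsupp.add_apply,
            Finsupp.single_apply]
          split_ifs with h
          · subst h; omega
          · rw [zero_add]
        rw [map_add, Finsupp.degree_single] at h3
        rw [hsupp] at h4
        have := Finset.card_erase_add_one hvB
        exact ⟨by omega, by omega, by omega, h4⟩
      · exact absurd rfl hm
    · exact absurd (coeff_zero m) hm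
  · change koszulD K _ = _
    funext B
    have hom := koszul_homotopy K v _ hDv B
    rw [eq_comm, ← sub_eq_zero, hom]
    split_ifs with hvB
    · rfl
    · ext m
      rw [coeff_zero]
      by_cases hle : Finsupp.single v 1 ≤ m
      · exact coeff_modMonomial_of_le _ hle
      · rw [coeff_modMonomial_of_not_le _ hle, coeff_firstSquarePart, if_neg]
        intro hsq
        have := hsq.1
        rw [Finsupp.add_apply, squarefreeExp_apply, if_neg hvB] at this
        rw [Finsupp.single_le_iff] at hle
        omega

/-- Hochster's formula: the graded Betti numbers of a Stanley-Reisner ideal are sums of the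
dimensions of the cohomologies of the induced subcomplexes. -/
theorem gradedBetti_eq_sum (hI : IsStanleyReisner I Δ) (i t : ℕ) :
    gradedBetti I i (i + t + 1) = ∑ W ∈ Finset.univ.powersetCard (i + t + 1),
      Module.finrank K (Cohomology K {F | F ∈ Δ ∧ F ⊆ W} t) := by
  rw [← Finset.sum_coe_sort, ← Submodule.finrank_quotient_pi, gradedBetti, eq_comm]
  have hcard : ∀ W : ↥((Finset.univ : Finset σ).powersetCard (i + t + 1)),
      W.1.card = i + t + 1 := fun W => (Finset.mem_powersetCard.mp W.2).2
  -- A family of cochains on the induced subcomplexes, extended to the simplices, is sent to the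
  -- Koszul boundary of the chain it defines: this is the connecting homomorphism of
  -- `0 → I → S → S / I → 0`.
  refine Submodule.finrank_quotient_submoduleOf_eq_of_map
    ((koszulD K).restrictScalars K ∘ₗ koszulChain _ (i + 1)) ?_ ?_ ?_
  · intro f hf
    refine ⟨?_, koszulD_koszulD K _⟩
    change koszulD K _ ∈ _
    rw [koszulD_koszulChain]
    exact hI.koszulChain_mem fun W G hG hGW hc => hf W (Set.mem_univ W) G ⟨hG, hGW⟩ (by omega)
  · intro f hf
    constructor
    · rintro ⟨b, hb, hbf⟩ W -
      replace hbf : koszulD K b = koszulD K (koszulChain _ (i + 1) f) := hbf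
      have hb' := hI.mem_koszulStrand_iff.mp hb
      obtain ⟨k, hk⟩ := (koszul_resolution K (koszulChain _ (i + 1) f - b)).mp
        ⟨by rw [map_sub, hbf, sub_self], by
          rw [constantCoeff_eq, Pi.sub_apply, coeff_sub, sub_eq_zero]
          rw [koszulChain_apply, if_neg (by simp), coeff_zero]
          by_contra hne
          exact absurd (hb' ∅ 0 (Ne.symm hne)).1 (by simp)⟩
      refine ⟨multidegreePart W k, fun F hF hc => ?_⟩
      have h1 := Finset.card_sdiff_add_card_eq_card hF.2
      rw [← multidegreePart_koszulD k hF.2, hk, multidegreePart_sub, Pi.sub_apply,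
        multidegreePart_koszulChain f W hF.2 (by have := hcard W; omega), eq_comm, sub_eq_self,
        multidegreePart]
      by_contra hne
      refine (hb' _ _ (right_ne_zero_of_mul hne)).2.2.2 ?_
      rw [support_squarefreeExp]
      exact hF.1
    · intro hf'
      choose g hg using fun W => hf' W (Set.mem_univ W)
      refine ⟨koszulChain _ (i + 1) (fun W => f W - coboundary K (g W)),
        hI.koszulChain_mem fun W F hF hFW hc => ?_, ?_⟩
      · change f W F - coboundary K (g W) F = 0
        rw [sub_eq_zero]
        exact hg W F ⟨hF, hFW⟩ (by omega)
      · change koszulD K _ = koszulD K _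
        rw [koszulD_koszulChain, koszulD_koszulChain]
        simp only [map_sub, coboundary_coboundary, sub_zero]
  · intro z hz
    have hz' := hI.mem_koszulStrand_iff.mp hz.1
    obtain ⟨b, hb⟩ := (koszul_resolution K z).mp ⟨hz.2, by
      rw [constantCoeff_eq]
      by_contra hne
      have := hz' ∅ 0 hne
      rw [map_zero] at this
      omega⟩
    have hcyc : ∀ (W : Finset σ), ∀ G ∈ Δ, G ⊆ W →
        coboundary K (multidegreePart W b) G = 0 := by
      intro W G hG hGW
      rw [← multidegreePart_koszulD b hGW, hb, multidegreePart]
      by_contra hne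
      refine (hz' _ _ (right_ne_zero_of_mul hne)).2.2.2 ?_
      rw [support_squarefreeExp]
      exact hG
    refine ⟨fun W => multidegreePart W b, fun W _ G hG _ => hcyc W G hG.1 hG.2, ?_⟩
    change z - koszulD K _ ∈ _
    rw [koszulD_koszulChain]
    have hmem : koszulChain (Finset.univ.powersetCard (i + t + 1)) i
        (fun W => coboundary K (multidegreePart W.1 b)) ∈ koszulStrand I i (i + t + 1) :=
      hI.koszulChain_mem fun W F hF hFW _ => hcyc W F hF hFW
    refine hI.mem_koszulBoundaries ⟨Submodule.sub_mem _ hz.1 hmem, ?_⟩ ?_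
    · change koszulD K _ = 0
      rw [map_sub, ← koszulD_koszulChain, koszulD_koszulD, sub_zero]
      exact hz.2
    · intro W F hF
      rw [multidegreePart_sub, Pi.sub_apply, sub_eq_zero]
      by_cases hcd : W.card = i + t + 1 ∧ (W \ F).card = i
      · rw [← hb, multidegreePart_koszulD b hF]
        exact (multidegreePart_koszulChain
          (fun W : ↥((Finset.univ : Finset σ).powersetCard (i + t + 1)) =>
            coboundary K (multidegreePart W.1 b))
          ⟨W, Finset.mem_powersetCard.mpr ⟨Finset.subset_univ W, hcd.1⟩⟩ hF hcd.2).symm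
      · -- Both chains live in homological degree `i` and internal degree `i + t + 1`.
        have hzero : ∀ c ∈ koszulStrand I i (i + t + 1), multidegreePart W c F = 0 := by
          intro c hc
          rw [multidegreePart]
          by_contra hne
          have h := hI.mem_koszulStrand_iff.mp hc _ _ (right_ne_zero_of_mul hne)
          rw [degree_squarefreeExp] at h
          have := Finset.card_sdiff_add_card_eq_card hF
          exact hcd ⟨by omega, h.1⟩
        rw [hzero z hz.1, hzero _ hmem]

end IsStanleyReisner

end Hochster

/-! ### Clique complexes of uniform clutters -/

section CliqueComplex

open MvPolynomial

namespace Clutter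

variable {α : Type*}

/-- The complex of cliques of the `d`-uniform clutter `C` which are contained in `W`. For
`W ⊆ C.verts` it is the subcomplex induced on `W` of the clique complex of `C`. -/
def cliquesIn (C : Clutter α) (d : ℕ) (W : Finset α) : Set (Finset α) :=
  {F | F ⊆ W ∧ ∀ T ⊆ F, T.card = d → T ∈ C.circuits}

theorem isLowerSet_cliquesIn (C : Clutter α) (d : ℕ) (W : Finset α) :
    IsLowerSet (C.cliquesIn d W) := fun _ _ h hF =>
  ⟨h.trans hF.1, fun T hT => hF.2 T (hT.trans h)⟩

theorem finite_cliquesIn (C : Clutter α) (d : ℕ) (W : Finset α) : (C.cliquesIn d W).Finite :=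
  W.powerset.finite_toSet.subset fun _ hF => Finset.mem_coe.mpr (Finset.mem_powerset.mpr hF.1)

/-- The vertices of a clique with at least `d` elements lie on circuits. -/
theorem subset_verts_of_forall_mem {C : Clutter α} {d : ℕ} (hd : 1 ≤ d) {F : Finset α}
    (hF : d ≤ F.card) (h : ∀ T ⊆ F, T.card = d → T ∈ C.circuits) : F ⊆ C.verts := by
  intro v hv
  obtain ⟨T, hvT, hTF, hTd⟩ := Finset.exists_subsuperset_card_eq
    (Finset.singleton_subset_iff.mpr hv) (by rwa [Finset.card_singleton]) hF
  exact C.subset_verts T (h T hTF hTd) (Finset.singleton_subset_iff.mp hvT)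

variable {K : Type*} [Field K]

variable [LinearOrder α]

theorem mem_circuitIdeal_iff (C : Clutter α) (d : ℕ) (p : MvPolynomial C.verts K) :
    p ∈ C.circuitIdeal K d ↔ ∀ m, coeff m p ≠ 0 →
      ∃ T ∈ C.complCircuits d, T ⊆ m.support.map (Function.Embedding.subtype _) := by
  have hI : C.circuitIdeal K d = Ideal.span ((fun s => monomial s (1 : K)) ''
      ((fun T : Finset α => squarefreeExp (T.subtype (· ∈ C.verts))) ''
        (C.complCircuits d : Set (Finset α)))) := by
    rw [circuitIdeal, Set.image_image]
    congr 2
    funext T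
    exact (monomial_squarefreeExp _).symm
  rw [hI, mem_ideal_span_monomial_image]
  simp only [mem_support_iff, Set.exists_mem_image, Finset.mem_coe]
  refine forall₂_congr fun m _ => exists_congr fun T => and_congr_right fun hT => ?_
  have hTV : T ⊆ C.verts :=
    (Finset.mem_powersetCard.mp (Finset.mem_sdiff.mp hT).1).1
  constructor
  · intro h v hv
    refine Finset.mem_map.mpr ⟨⟨v, hTV hv⟩, ?_, rfl⟩
    have := h ⟨v, hTV hv⟩
    rw [squarefreeExp_apply, if_pos (Finset.mem_subtype.mpr hv)] at this
    exact Finsupp.mem_support_iff.mpr (by omega)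
  · intro h v
    rw [squarefreeExp_apply]
    split_ifs with hv
    · obtain ⟨u, hu, huv⟩ := Finset.mem_map.mp (h (Finset.mem_subtype.mp hv))
      rw [← Subtype.ext huv]
      exact Nat.one_le_iff_ne_zero.mpr (Finsupp.mem_support_iff.mp hu)
    · exact Nat.zero_le _

theorem mem_complCircuits {C : Clutter α} {d : ℕ} {T : Finset α} :
    T ∈ C.complCircuits d ↔ (T ⊆ C.verts ∧ T.card = d) ∧ T ∉ C.circuits := by
  rw [complCircuits, Finset.mem_sdiff, Finset.mem_powersetCard]

theorem circuitIdeal_ne_bot_iff {C : Clutter α} {d : ℕ} :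
    C.circuitIdeal K d ≠ ⊥ ↔ ∃ T ⊆ C.verts, T.card = d ∧ T ∉ C.circuits := by
  constructor
  · intro h
    obtain ⟨p, hp, hne⟩ := Submodule.exists_mem_ne_zero_of_ne_bot h
    obtain ⟨m, hm⟩ := ne_zero_iff.mp hne
    obtain ⟨T, hT, -⟩ := (mem_circuitIdeal_iff C d p).mp hp m hm
    rw [mem_complCircuits] at hT
    exact ⟨T, hT.1.1, hT.1.2, hT.2⟩
  · rintro ⟨T, hTV, hTd, hT⟩ h
    have hmem : ∏ v ∈ T.subtype (· ∈ C.verts), (X v : MvPolynomial C.verts K) ∈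
        C.circuitIdeal K d :=
      Ideal.subset_span ⟨T, Finset.mem_coe.mpr (mem_complCircuits.mpr ⟨⟨hTV, hTd⟩, hT⟩), rfl⟩
    rw [h, Ideal.mem_bot, ← monomial_squarefreeExp, monomial_eq_zero] at hmem
    exact one_ne_zero hmem

theorem isStanleyReisner_circuitIdeal (C : Clutter α) (d : ℕ) :
    IsStanleyReisner (C.circuitIdeal K d)
      {F : Finset C.verts | F.map (Function.Embedding.subtype _) ∈ C.cliquesIn d C.verts} where
  isLowerSet _ _ h hF := C.isLowerSet_cliquesIn d C.verts (Finset.map_subset_map.mpr h) hF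
  mem_iff p := by
    rw [mem_circuitIdeal_iff]
    refine forall₂_congr fun m _ => ?_
    have hV : m.support.map (Function.Embedding.subtype _) ⊆ C.verts := fun v hv =>
      Finset.property_of_mem_map_subtype _ hv
    constructor
    · rintro ⟨T, hT, hTm⟩ h
      rw [mem_complCircuits] at hT
      exact hT.2 (h.2 T hTm hT.1.2)
    · intro h
      by_contra hne
      refine h ⟨hV, fun T hTm hTd => ?_⟩
      by_contra hT
      exact hne ⟨T, mem_complCircuits.mpr ⟨⟨hTm.trans hV, hTd⟩, hT⟩, hTm⟩

theorem gradedBetti_circuitIdeal (C : Clutter α) (d i t : ℕ) :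
    gradedBetti (C.circuitIdeal K d) i (i + t + 1) =
      ∑ W ∈ C.verts.powersetCard (i + t + 1),
        Module.finrank K (Cohomology K (C.cliquesIn d W) t) := by
  have hverts : (Finset.univ : Finset C.verts).map (Function.Embedding.subtype _) = C.verts := by
    rw [Finset.univ_eq_attach, Finset.attach_map_val]
  rw [(isStanleyReisner_circuitIdeal C d).gradedBetti_eq_sum]
  conv_rhs => rw [← hverts, Finset.powersetCard_map, Finset.sum_map]
  refine Finset.sum_congr rfl fun W _ => (finrank_cohomology_map
    (OrderEmbedding.subtype (· ∈ C.verts)) (fun F' => ?_) t).symm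
  have hW : W.map (Function.Embedding.subtype _) ⊆ C.verts := fun v hv =>
    Finset.property_of_mem_map_subtype _ hv
  constructor
  · rintro ⟨h1, h2⟩
    obtain ⟨F, hF, rfl⟩ := Finset.subset_map_iff.mp h1
    exact ⟨F, ⟨⟨h1.trans hW, h2⟩, hF⟩, rfl⟩
  · rintro ⟨F, ⟨⟨_, h2⟩, h3⟩, rfl⟩
    exact ⟨Finset.map_subset_map.mpr h3, h2⟩

/-- Nonzero elements of a circuit ideal have degree at least `d`. -/
theorem gradedBetti_circuitIdeal_eq_zero (C : Clutter α) {d i j : ℕ} (hij : j < i + d) :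
    gradedBetti (C.circuitIdeal K d) i j = 0 := by
  have hbot : koszulCycles (C.circuitIdeal K d) i j = ⊥ := by
    rw [eq_bot_iff]
    rintro c ⟨hc, -⟩
    rw [Submodule.mem_bot]
    funext A
    ext m
    by_contra hm
    obtain ⟨-, hle, hdeg, hface⟩ :=
      (isStanleyReisner_circuitIdeal C d).mem_koszulStrand_iff.mp hc A m hm
    refine hface ⟨fun v hv => Finset.property_of_mem_map_subtype _ hv, fun T hT hTd => ?_⟩
    have h1 := Finset.card_le_card hT
    have h2 : m.support.card ≤ m.degree := by
      rw [Finset.card_eq_sum_ones, Finsupp.degree_apply]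
      exact Finset.sum_le_sum fun v hv =>
        Nat.one_le_iff_ne_zero.mpr (Finsupp.mem_support_iff.mp hv)
    rw [Finset.card_map] at h1
    omega
  rw [gradedBetti, hbot]
  exact Module.finrank_zero_of_subsingleton

/-- A nonzero circuit ideal has a minimal generator of degree `d`: over a `d`-set which is not a
circuit, the clique complex is the boundary of a simplex. -/
theorem gradedBetti_circuitIdeal_zero_ne_zero {C : Clutter α} {d : ℕ} (hd : 1 ≤ d)
    (hC : C.circuitIdeal K d ≠ ⊥) : gradedBetti (C.circuitIdeal K d) 0 d ≠ 0 := by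
  obtain ⟨T, hTV, hTd, hT⟩ := circuitIdeal_ne_bot_iff.mp hC
  obtain ⟨t, rfl⟩ : ∃ t, d = t + 1 := ⟨d - 1, by omega⟩
  have hformula := gradedBetti_circuitIdeal (K := K) C (t + 1) 0 t
  rw [zero_add] at hformula
  rw [hformula]
  intro h0
  rw [Finset.sum_eq_zero_iff] at h0
  have h1 := h0 T (Finset.mem_powersetCard.mpr ⟨hTV, hTd⟩)
  have := Cohomology.finite (K := K) (C.finite_cliquesIn (t + 1) T) t
    (C.isLowerSet_cliquesIn (t + 1) T)
  rw [Module.finrank_zero_iff, Submodule.Quotient.subsingleton_iff,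
    Submodule.submoduleOf_eq_top] at h1
  obtain ⟨v, hv⟩ : T.Nonempty := Finset.card_pos.mp (by omega)
  have hcyc : Pi.single (T.erase v) (1 : K) ∈ cocycles K (C.cliquesIn (t + 1) T) t := by
    intro G hG hc
    have hGT : G = T := Finset.eq_of_subset_of_card_le hG.1 (by omega)
    rw [hGT] at hG
    exact absurd (hG.2 T subset_rfl hTd) hT
  obtain ⟨g, hg⟩ := h1 hcyc
  have h2 : coboundary K (Pi.single (T.erase v) (1 : K)) T =
      coboundary K (coboundary K g) T := by
    refine coboundary_congr fun u hu => ?_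
    have hcard : (T.erase u).card = t := by rw [Finset.card_erase_of_mem hu]; omega
    refine hg _ ⟨Finset.erase_subset u T, fun T' hT' hd' => ?_⟩ hcard
    have := Finset.card_le_card hT'
    omega
  rw [coboundary_coboundary, Pi.zero_apply, coboundary_apply, Finset.sum_eq_single_of_mem v hv,
    Pi.single_eq_same, mul_one] at h2
  · have := faceSign_mul_self K v T
    rw [h2, mul_zero] at this
    exact zero_ne_one this
  · intro u hu huv
    rw [Pi.single_eq_of_ne, mul_zero]
    intro h
    exact Finset.notMem_erase u T (h ▸ Finset.mem_erase.mpr ⟨huv, hu⟩)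

/-! ### Decompositions of clutters -/

/-- If every `d`-subset of `V` is a circuit and the two parts share no submaximal circuit, then all
these circuits belong to the same part: the `d`-subsets of `V` are connected by exchanging one
vertex at a time, and such an exchange keeps a `(d-1)`-subset. -/
theorem forall_mem_of_submaximal_disjoint {C₁ C₂ : Clutter α} {d : ℕ}
    (hdisj : C₁.submaximal d ∩ C₂.submaximal d = ∅) {V : Finset α}
    (hV : ∀ T ⊆ V, T.card = d → T ∈ C₁.circuits ∨ T ∈ C₂.circuits) {T : Finset α} (hTV : T ⊆ V)
    (hTd : T.card = d) (hT : T ∈ C₁.circuits) :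
    ∀ T' ⊆ V, T'.card = d → T' ∈ C₁.circuits := by
  intro T' hTV' hTd'
  induction hn : (T' \ T).card generalizing T with
  | zero =>
    rw [Finset.card_eq_zero, Finset.sdiff_eq_empty_iff_subset] at hn
    rwa [Finset.eq_of_subset_of_card_le hn (by omega)]
  | succ n ih =>
    obtain ⟨b, hb⟩ : (T' \ T).Nonempty := Finset.card_pos.mp (by omega)
    obtain ⟨a, ha⟩ : (T \ T').Nonempty := by
      rw [← Finset.card_pos, Finset.card_sdiff_comm (by omega)]
      omega
    rw [Finset.mem_sdiff] at ha hb
    have hbE : b ∉ T.erase a := fun h => hb.2 (Finset.mem_of_mem_erase h)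
    have hEd : (T.erase a).card + 1 = d := by rw [Finset.card_erase_add_one ha.1, hTd]
    have hSV : insert b (T.erase a) ⊆ V :=
      Finset.insert_subset (hTV' hb.1) ((Finset.erase_subset a T).trans hTV)
    have hSd : (insert b (T.erase a)).card = d := by
      rw [Finset.card_insert_of_notMem hbE, hEd]
    refine ih hSV hSd ?_ ?_
    · refine (hV _ hSV hSd).resolve_right fun h => ?_
      have : T.erase a ∈ C₁.submaximal d ∩ C₂.submaximal d :=
        ⟨⟨hEd, T, hT, Finset.erase_subset a T⟩, ⟨hEd, _, h, Finset.subset_insert b _⟩⟩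
      rw [hdisj] at this
      exact this
    · have : T' \ insert b (T.erase a) = (T' \ T).erase b := by
        ext x
        simp only [Finset.mem_sdiff, Finset.mem_insert, Finset.mem_erase, not_or, not_and]
        constructor
        · rintro ⟨h1, h2, h3⟩
          exact ⟨h2, h1, h3 fun h => ha.2 (h ▸ h1)⟩
        · rintro ⟨h1, h2, h3⟩
          exact ⟨h2, h1, fun _ => h3⟩
      rw [this, Finset.card_erase_of_mem (Finset.mem_sdiff.mpr hb), hn, Nat.add_sub_cancel]

theorem mem_cliquesIn_one (C : Clutter α) (W F : Finset α) :
    F ∈ C.cliquesIn 1 W ↔ F ⊆ W.filter fun v => {v} ∈ C.circuits := by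
  constructor
  · intro h v hv
    exact Finset.mem_filter.mpr
      ⟨h.1 hv, h.2 {v} (Finset.singleton_subset_iff.mpr hv) (Finset.card_singleton v)⟩
  · intro h
    refine ⟨h.trans (Finset.filter_subset _ W), fun T hT hc => ?_⟩
    obtain ⟨v, rfl⟩ := Finset.card_eq_one.mp hc
    exact (Finset.mem_filter.mp (h (Finset.singleton_subset_iff.mp hT))).2

namespace IsDecomposition

variable {d : ℕ} {C C₁ C₂ : Clutter α}

theorem mem_circuits (h : IsDecomposition d C C₁ C₂) {T : Finset α} :
    T ∈ C.circuits ↔ T ∈ C₁.circuits ∨ T ∈ C₂.circuits := by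
  rw [h.circuits_eq, Finset.mem_union]

/-- A `d`-set of vertices of `C₁` which belongs to `C₂` belongs to `C₁`, if the common vertices
form a clique of `C₁`. -/
theorem mem_left_of_subset (h : IsDecomposition d C C₁ C₂)
    (hc : C₁.IsClique d (C₁.verts ∩ C₂.verts)) {T : Finset α} (hT : T ⊆ C₁.verts)
    (hTd : T.card = d) (hTC : T ∈ C.circuits) : T ∈ C₁.circuits := by
  rcases h.mem_circuits.mp hTC with h1 | h2
  · exact h1
  · exact hc.2 T (Finset.subset_inter hT (C₂.subset_verts T h2)) hTd

protected theorem symm (h : IsDecomposition d C C₁ C₂) : IsDecomposition d C C₂ C₁ where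
  uniform := h.uniform
  verts_left := h.verts_right
  verts_right := h.verts_left
  circuits_eq := by rw [h.circuits_eq, Finset.union_comm]
  glue := by
    rw [Finset.inter_comm C₂.verts, Set.inter_comm]
    exact h.glue.imp_left And.symm

/-- A clique of `C` with at least `d` elements is a clique of one of the two parts. If the common
vertices form a clique, this needs `2 ≤ d`: a clique with a vertex outside of `C₁` and a vertex
outside of `C₂` would contain a `d`-set through both, which is a circuit of neither. -/
theorem forall_mem_or_forall_mem (h : IsDecomposition d C C₁ C₂)
    (hglue : 2 ≤ d ∨ C₁.submaximal d ∩ C₂.submaximal d = ∅) {F : Finset α} (hF : d ≤ F.card)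
    (hFC : ∀ T ⊆ F, T.card = d → T ∈ C.circuits) :
    (∀ T ⊆ F, T.card = d → T ∈ C₁.circuits) ∨ (∀ T ⊆ F, T.card = d → T ∈ C₂.circuits) := by
  by_cases hdisj : C₁.submaximal d ∩ C₂.submaximal d = ∅
  · have hcover := fun T hT hTd => h.mem_circuits.mp (hFC T hT hTd)
    obtain ⟨T, hTF, hTd⟩ := Finset.exists_subset_card_eq hF
    rcases hcover T hTF hTd with h1 | h2
    · exact Or.inl (forall_mem_of_submaximal_disjoint hdisj hcover hTF hTd h1)
    · refine Or.inr (forall_mem_of_submaximal_disjoint ?_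
        (fun T hT hTd => (hcover T hT hTd).symm) hTF hTd h2)
      rwa [Set.inter_comm]
  · obtain ⟨hc₁, hc₂⟩ := h.glue.resolve_right hdisj
    have hd2 := hglue.resolve_right hdisj
    by_cases h1 : F ⊆ C₁.verts
    · exact Or.inl fun T hT hTd => h.mem_left_of_subset hc₁ (hT.trans h1) hTd (hFC T hT hTd)
    by_cases h2 : F ⊆ C₂.verts
    · rw [Finset.inter_comm] at hc₂
      exact Or.inr fun T hT hTd =>
        h.symm.mem_left_of_subset hc₂ (hT.trans h2) hTd (hFC T hT hTd)
    obtain ⟨a, haF, ha⟩ := Finset.not_subset.mp h1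
    obtain ⟨b, hbF, hb⟩ := Finset.not_subset.mp h2
    obtain ⟨T, habT, hTF, hTd⟩ := Finset.exists_subsuperset_card_eq
      (Finset.insert_subset haF (Finset.singleton_subset_iff.mpr hbF))
      (Finset.card_le_two.trans hd2) hF
    rcases h.mem_circuits.mp (hFC T hTF hTd) with hT | hT
    · exact absurd (C₁.subset_verts T hT (habT (by simp))) ha
    · exact absurd (C₂.subset_verts T hT (habT (by simp))) hb

/-- In dimension at least `d - 1`, the cohomology of an induced subcomplex of the clique complex of
`C` is the direct sum of those of the parts. -/
theorem finrank_cohomology (h : IsDecomposition d C C₁ C₂) (hd : 1 ≤ d) {t : ℕ} (ht : d ≤ t)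
    (W : Finset α) :
    Module.finrank K (Cohomology K (C.cliquesIn d W) t) =
      Module.finrank K (Cohomology K (C₁.cliquesIn d (W ∩ C₁.verts)) t) +
        Module.finrank K (Cohomology K (C₂.cliquesIn d (W ∩ C₂.verts)) t) := by
  by_cases hglue : 2 ≤ d ∨ C₁.submaximal d ∩ C₂.submaximal d = ∅
  swap
  · -- All clique complexes of a `1`-uniform clutter are simplices.
    obtain rfl : d = 1 := by
      by_contra hne
      exact hglue (Or.inl (by omega))
    rw [finrank_cohomology_simplex ht (C.mem_cliquesIn_one W),
      finrank_cohomology_simplex ht (C₁.mem_cliquesIn_one _),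
      finrank_cohomology_simplex ht (C₂.mem_cliquesIn_one _)]
  have hunion : ∀ F : Finset α, t ≤ F.card → (F ∈ C.cliquesIn d W ↔
      F ∈ C₁.cliquesIn d (W ∩ C₁.verts) ∨ F ∈ C₂.cliquesIn d (W ∩ C₂.verts)) := by
    intro F hF
    constructor
    · rintro ⟨hFW, hFC⟩
      refine (h.forall_mem_or_forall_mem hglue (ht.trans hF) hFC).imp (fun h1 => ?_)
        (fun h2 => ?_)
      · exact ⟨Finset.subset_inter hFW (subset_verts_of_forall_mem hd (ht.trans hF) h1), h1⟩
      · exact ⟨Finset.subset_inter hFW (subset_verts_of_forall_mem hd (ht.trans hF) h2), h2⟩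
    · rintro (⟨hFW, hF1⟩ | ⟨hFW, hF2⟩)
      · exact ⟨hFW.trans Finset.inter_subset_left, fun T hT hTd =>
          h.mem_circuits.mpr (Or.inl (hF1 T hT hTd))⟩
      · exact ⟨hFW.trans Finset.inter_subset_left, fun T hT hTd =>
          h.mem_circuits.mpr (Or.inr (hF2 T hT hTd))⟩
  by_cases hdisj : C₁.submaximal d ∩ C₂.submaximal d = ∅
  · -- The two parts have no common `(t - 1)`-subfaces at all; the common simplex is empty.
    have hno : ∀ F₁ ∈ C₁.cliquesIn d (W ∩ C₁.verts), ∀ F₂ ∈ C₂.cliquesIn d (W ∩ C₂.verts),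
        F₁.card = t → F₂.card = t → ∀ E ⊆ F₁, E ⊆ F₂ → E.card + 1 = t → False := by
      intro F₁ hF₁ F₂ hF₂ hc₁ hc₂ E hE₁ hE₂ hEt
      obtain ⟨E', hE', hEd⟩ := Finset.exists_subset_card_eq (s := E) (n := d - 1) (by omega)
      obtain ⟨T₁, hET₁, hT₁, hTd₁⟩ := Finset.exists_subsuperset_card_eq (n := d)
        (hE'.trans hE₁) (by omega) (by omega)
      obtain ⟨T₂, hET₂, hT₂, hTd₂⟩ := Finset.exists_subsuperset_card_eq (n := d)
        (hE'.trans hE₂) (by omega) (by omega)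
      have : E' ∈ C₁.submaximal d ∩ C₂.submaximal d :=
        ⟨⟨by omega, T₁, hF₁.2 T₁ hT₁ hTd₁, hET₁⟩, ⟨by omega, T₂, hF₂.2 T₂ hT₂ hTd₂, hET₂⟩⟩
      rw [hdisj] at this
      exact this
    refine finrank_cohomology_union (hd.trans ht) ∅ (C₁.isLowerSet_cliquesIn _ _)
      (C₂.isLowerSet_cliquesIn _ _) (C₁.finite_cliquesIn _ _) (C₂.finite_cliquesIn _ _)
      hunion ?_ ?_ ?_
    · intro F hF
      rw [Finset.subset_empty] at hF
      subst hF
      refine ⟨⟨Finset.empty_subset _, fun T hT hTd => ?_⟩,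
        ⟨Finset.empty_subset _, fun T hT hTd => ?_⟩⟩ <;>
      · have := Finset.card_le_card hT
        rw [Finset.card_empty] at this
        omega
    · intro F h1 h2 hc
      obtain ⟨E, hE, hEt⟩ := Finset.exists_subset_card_eq (s := F) (n := t - 1) (by omega)
      exact (hno F h1 F h2 hc hc E hE hE (by omega)).elim
    · intro F₁ h1 F₂ h2 hc₁ hc₂ E hE₁ hE₂ hEt
      exact (hno F₁ h1 F₂ h2 hc₁ hc₂ E hE₁ hE₂ hEt).elim
  · -- The two complexes meet in the simplex on the common vertices.
    obtain ⟨hc₁, hc₂⟩ := h.glue.resolve_right hdisj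
    have hd2 := hglue.resolve_right hdisj
    refine finrank_cohomology_union (hd.trans ht) (W ∩ (C₁.verts ∩ C₂.verts))
      (C₁.isLowerSet_cliquesIn _ _) (C₂.isLowerSet_cliquesIn _ _) (C₁.finite_cliquesIn _ _)
      (C₂.finite_cliquesIn _ _) hunion ?_ ?_ ?_
    · intro F hF
      have hFW := hF.trans Finset.inter_subset_left
      have hFV := hF.trans Finset.inter_subset_right
      exact ⟨⟨Finset.subset_inter hFW (hFV.trans Finset.inter_subset_left),
          fun T hT => hc₁.2 T (hT.trans hFV)⟩,
        ⟨Finset.subset_inter hFW (hFV.trans Finset.inter_subset_right),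
          fun T hT => hc₂.2 T (hT.trans hFV)⟩⟩
    · intro F h1 h2 _ v hv
      have hv1 := Finset.mem_inter.mp (h1.1 hv)
      have hv2 := Finset.mem_inter.mp (h2.1 hv)
      exact Finset.mem_inter.mpr ⟨hv1.1, Finset.mem_inter.mpr ⟨hv1.2, hv2.2⟩⟩
    · intro F₁ h1 F₂ h2 _ _ E hE₁ hE₂ hEt
      have hEV : E ⊆ W ∩ (C₁.verts ∩ C₂.verts) := fun v hv => by
        have hv1 := Finset.mem_inter.mp (h1.1 (hE₁ hv))
        have hv2 := Finset.mem_inter.mp (h2.1 (hE₂ hv))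
        exact Finset.mem_inter.mpr ⟨hv1.1, Finset.mem_inter.mpr ⟨hv1.2, hv2.2⟩⟩
      exact ⟨hEV, (Finset.card_pos.mp (by omega)).mono hEV⟩

theorem gradedBetti_add_le (h : IsDecomposition d C C₁ C₂) (hd : 1 ≤ d) {i j : ℕ}
    (hij : i + d < j) :
    gradedBetti (C₁.circuitIdeal K d) i j + gradedBetti (C₂.circuitIdeal K d) i j ≤
      gradedBetti (C.circuitIdeal K d) i j := by
  obtain ⟨t, rfl⟩ : ∃ t, j = i + t + 1 := ⟨j - i - 1, by omega⟩
  simp only [gradedBetti_circuitIdeal]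
  rw [Finset.sum_congr rfl fun W _ => h.finrank_cohomology (K := K) hd (t := t) (by omega) W,
    Finset.sum_add_distrib]
  -- Only the summands with `W ⊆ V(C₁)`, respectively `W ⊆ V(C₂)`, are kept.
  have key : ∀ C' : Clutter α, C'.verts ⊆ C.verts →
      ∑ W ∈ C'.verts.powersetCard (i + t + 1),
          Module.finrank K (Cohomology K (C'.cliquesIn d W) t) ≤
        ∑ W ∈ C.verts.powersetCard (i + t + 1),
          Module.finrank K (Cohomology K (C'.cliquesIn d (W ∩ C'.verts)) t) := by
    intro C' hC'
    refine le_of_eq_of_le (Finset.sum_congr rfl fun W hW => ?_)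
      (Finset.sum_le_sum_of_subset (Finset.powersetCard_mono hC'))
    rw [Finset.inter_eq_left.mpr (Finset.mem_powersetCard.mp hW).1]
  exact Nat.add_le_add (key C₁ h.verts_left) (key C₂ h.verts_right)

/-- Above the linear strand, the nonzero Betti numbers of `C` lie on the diagonals `j - i` where
one of the parts has a nonzero Betti number. -/
theorem exists_gradedBetti_ne_zero (h : IsDecomposition d C C₁ C₂) (hd : 1 ≤ d) {i t : ℕ}
    (ht : d ≤ t) (hb : gradedBetti (C.circuitIdeal K d) i (i + t + 1) ≠ 0) :
    (∃ i', gradedBetti (C₁.circuitIdeal K d) i' (i' + t + 1) ≠ 0) ∨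
      ∃ i', gradedBetti (C₂.circuitIdeal K d) i' (i' + t + 1) ≠ 0 := by
  rw [gradedBetti_circuitIdeal] at hb
  obtain ⟨W, -, hW⟩ := Finset.exists_ne_zero_of_sum_ne_zero hb
  rw [h.finrank_cohomology hd ht] at hW
  -- On at most `t` vertices there is no cohomology on the faces with `t` elements: every function
  -- is a cocycle on the full simplex, hence a coboundary. So the homological degree `i'` below is
  -- not truncated.
  have key : ∀ C' : Clutter α,
      Module.finrank K (Cohomology K (C'.cliquesIn d (W ∩ C'.verts)) t) ≠ 0 →
      ∃ i', gradedBetti (C'.circuitIdeal K d) i' (i' + t + 1) ≠ 0 := by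
    intro C' hne
    have hcard : t + 1 ≤ (W ∩ C'.verts).card := by
      by_contra hlt
      refine hne ?_
      have : Subsingleton (Cohomology K (C'.cliquesIn d (W ∩ C'.verts)) t) := by
        rw [Submodule.Quotient.subsingleton_iff, Submodule.submoduleOf_eq_top]
        intro f _
        obtain ⟨g, hg⟩ := exists_eq_coboundary_of_subset (W ∩ C'.verts) t f
          (Or.inr (hd.trans ht)) fun G hG hc => by
            have := Finset.card_le_card hG
            omega
        exact ⟨g, fun F hF => hg F hF.1⟩
      exact Module.finrank_zero_of_subsingleton
    refine ⟨(W ∩ C'.verts).card - t - 1, ?_⟩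
    rw [gradedBetti_circuitIdeal]
    intro h0
    refine hne (Finset.sum_eq_zero_iff.mp h0 _ (Finset.mem_powersetCard.mpr
      ⟨Finset.inter_subset_right, by omega⟩))
  by_cases h1 : Module.finrank K (Cohomology K (C₁.cliquesIn d (W ∩ C₁.verts)) t) = 0
  · rw [h1, zero_add] at hW
    exact Or.inr (key C₂ hW)
  · exact Or.inl (key C₁ h1)

theorem circuitIdeal_ne_bot (h : IsDecomposition d C C₁ C₂)
    (h₁ : C₁.circuitIdeal K d ≠ ⊥) (h₂ : C₂.circuitIdeal K d ≠ ⊥) : C.circuitIdeal K d ≠ ⊥ := by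
  rw [circuitIdeal_ne_bot_iff] at h₁ h₂ ⊢
  obtain ⟨T₁, hV₁, hd₁, hT₁⟩ := h₁
  obtain ⟨T₂, hV₂, hd₂, hT₂⟩ := h₂
  by_contra! hC
  rcases h.glue with ⟨hc, -⟩ | hdisj
  · exact hT₁ (h.mem_left_of_subset hc hV₁ hd₁ (hC T₁ (hV₁.trans h.verts_left) hd₁))
  · have hcover := fun T hT hTd => h.mem_circuits.mp (hC T hT hTd)
    have hT₂' := (hcover T₂ (hV₂.trans h.verts_right) hd₂).resolve_right hT₂
    exact hT₁ (forall_mem_of_submaximal_disjoint hdisj hcover (hV₂.trans h.verts_right) hd₂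
      hT₂' T₁ (hV₁.trans h.verts_left) hd₁)

end IsDecomposition

end Clutter

/-! ### Regularity -/

theorem le_regularity {K : Type*} [Field K] {σ : Type*} [Fintype σ] [LinearOrder σ]
    {I : Ideal (MvPolynomial σ K)} {i j : ℕ} (h : gradedBetti I i j ≠ 0) :
    (((j : ℝ) - (i : ℝ) : ℝ) : EReal) ≤ regularity I :=
  le_iSup₂_of_le i j (le_iSup_of_le h le_rfl)

theorem regularity_le_iff {K : Type*} [Field K] {σ : Type*} [Fintype σ] [LinearOrder σ]
    {I : Ideal (MvPolynomial σ K)} {r : EReal} :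
    regularity I ≤ r ↔
      ∀ i j : ℕ, gradedBetti I i j ≠ 0 → (((j : ℝ) - (i : ℝ) : ℝ) : EReal) ≤ r := by
  simp only [regularity, iSup_le_iff]

/-- A nonzero circuit ideal has regularity at least `d`. -/
theorem Clutter.natCast_le_regularity {K : Type*} [Field K] {α : Type*} [LinearOrder α]
    {C : Clutter α} {d : ℕ} (hd : 1 ≤ d) (hC : C.circuitIdeal K d ≠ ⊥) :
    ((d : ℝ) : EReal) ≤ regularity (C.circuitIdeal K d) := by
  have := le_regularity (Clutter.gradedBetti_circuitIdeal_zero_ne_zero hd hC)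
  rwa [Nat.cast_zero, sub_zero] at this

theorem Clutter.regularity_le_of_forall {K : Type*} [Field K] {α : Type*} [LinearOrder α]
    {C : Clutter α} {d : ℕ} {r : EReal} (hr : ((d : ℝ) : EReal) ≤ r)
    (h : ∀ i j : ℕ, i + d < j → gradedBetti (C.circuitIdeal K d) i j ≠ 0 →
      (((j : ℝ) - (i : ℝ) : ℝ) : EReal) ≤ r) : regularity (C.circuitIdeal K d) ≤ r := by
  rw [regularity_le_iff]
  intro i j hb
  rcases lt_trichotomy (i + d) j with hlt | rfl | hgt
  · exact h i j hlt hb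
  · rwa [Nat.cast_add, add_sub_cancel_left]
  · exact absurd (Clutter.gradedBetti_circuitIdeal_eq_zero C hgt) hb

theorem mainTheorem1 {K : Type*} [Field K] {α : Type*} [LinearOrder α] {d : ℕ} (hd : 1 ≤ d)
    (C C₁ C₂ : Clutter α) (h : Clutter.IsDecomposition d C C₁ C₂) :
    (∀ i j : ℕ, i + d < j →
      gradedBetti (C₁.circuitIdeal K d) i j + gradedBetti (C₂.circuitIdeal K d) i j ≤
        gradedBetti (C.circuitIdeal K d) i j) ∧
    (C₁.circuitIdeal K d ≠ ⊥ → C₂.circuitIdeal K d ≠ ⊥ →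
      regularity (C.circuitIdeal K d) =
        max (regularity (C₁.circuitIdeal K d)) (regularity (C₂.circuitIdeal K d))) := by
  refine ⟨fun i j hij => h.gradedBetti_add_le hd hij, fun h₁ h₂ => le_antisymm ?_ (max_le ?_ ?_)⟩
  · refine Clutter.regularity_le_of_forall
      ((Clutter.natCast_le_regularity hd h₁).trans (le_max_left _ _)) fun i j hij hb => ?_
    obtain ⟨t, rfl⟩ : ∃ t, j = i + t + 1 := ⟨j - i - 1, by omega⟩
    have hdiag : ∀ i' : ℕ, (((i + t + 1 : ℕ) : ℝ) - (i : ℝ)) =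
        ((i' + t + 1 : ℕ) : ℝ) - (i' : ℝ) := fun i' => by push_cast; ring
    rcases h.exists_gradedBetti_ne_zero hd (by omega) hb with ⟨i', hb'⟩ | ⟨i', hb'⟩
    · rw [hdiag i']
      exact (le_regularity hb').trans (le_max_left _ _)
    · rw [hdiag i']
      exact (le_regularity hb').trans (le_max_right _ _)
  · refine Clutter.regularity_le_of_forall
      (Clutter.natCast_le_regularity hd (h.circuitIdeal_ne_bot h₁ h₂)) fun i j hij hb => ?_
    exact le_regularity (by have := h.gradedBetti_add_le (K := K) hd hij; omega)
  · refine Clutter.regularity_le_of_forall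
      (Clutter.natCast_le_regularity hd (h.circuitIdeal_ne_bot h₁ h₂)) fun i j hij hb => ?_
    exact le_regularity (by have := h.gradedBetti_add_le (K := K) hd hij; omega)

end CliqueComplex
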